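/- Let $\lambda,\mu,c,B>0$ and $\bar p\in(0,1)$, and let $V:[0,\infty)\to\mathbb{R}$ be three times continuously differentiable with $V(0)=0$, $V'(\tau)>0$ and $-V''(\tau)/V'(\tau)\ge \bar p\lambda$ for all $\tau\ge 0$, and with a finite limit $V(\infty)=\lim_{\tau\to\infty}V(\tau)>c/\mu$. For a deadline $T>0$, a policy is a measurable function $a:[0,T]\to[0,1]$, where $a_\tau$ is the share of effort devoted to doing, and $1-a_\tau$ the share devoted to thinking, when time $\tau$ remains and neither a solution nor progress has arrived yet (full effort is exerted throughout). Put $A_\tau=\int_\tau^T a_s\,ds$ and $p_\tau=\bar p e^{-\lambda A_\tau}/(\bar p e^{-\lambda A_\tau}+1-\bar p)$. A policy is optimal if it maximizes, among all policies, the expected payoff \[ \int_0^T e^{-\mu(T-\tau-A_\tau)}\bigl(1-\bar p+\bar p e^{-\lambda A_\tau}\bigr)\bigl(\mu(1-a_\tau)V(\tau)+\lambda a_\tau p_\tau B-c\bigr)\,d\tau . \] For every $T>0$ an optimal policy exists, it is unique up to null sets, and there are unique lengths $\tau_1(T),\tau_2(T),\tau_3(T)\ge 0$ with $\tau_1(T)+\tau_2(T)+\tau_3(T)=T$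 such that, in the order of calendar time, the agent first does ($a=1$) for a time $\tau_1(T)$, then thinks ($a=0$) for a time $\tau_2(T)$, and then does ($a=1$) for the remaining time $\tau_3(T)$; if she never thinks, all doing is counted in the final period, that is, $\tau_1(T)=\tau_2(T)=0$ and $\tau_3(T)=T$. The length $\tau_1(T)$ of the initial doing period and the length $\tau_2(T)$ of the thinking period are nondecreasing in $T$ on $(0,\infty)$, and $\tau_2(T)\to\infty$ as $T\to\infty$. -/

import Mathlib

open MeasureTheory Set Filter Topology

noncomputable section

/-- The primitives of the problem: the arrival rate `lam` of a solution on a good doing arm, the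
arrival rate `mu` of progress on the thinking arm, the flow cost of effort `c`, the payoff `B` of a
solution, the prior `pbar` that the doing arm is good, and the value `V τ` of progress that arrives
with time `τ` remaining. -/
structure ThinkDo where
  lam : ℝ
  mu : ℝ
  c : ℝ
  B : ℝ
  pbar : ℝ
  V : ℝ → ℝ

namespace ThinkDo

/-- The derivative of the value of progress on `[0, ∞)` (one-sided at `0`). -/
def V' (P : ThinkDo) : ℝ → ℝ := derivWithin P.V (Ici 0)

/-- The second derivative of the value of progress on `[0, ∞)` (one-sided at `0`). -/
def V'' (P : ThinkDo) : ℝ → ℝ := derivWithin P.V' (Ici 0)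

/-- The standing assumptions on the primitives. -/
structure Standing (P : ThinkDo) : Prop where
  lam_pos : 0 < P.lam
  mu_pos : 0 < P.mu
  c_pos : 0 < P.c
  B_pos : 0 < P.B
  pbar_mem : P.pbar ∈ Ioo (0 : ℝ) 1
  smooth : ContDiffOn ℝ 3 P.V (Ici 0)
  V_zero : P.V 0 = 0
  increasing : ∀ τ, 0 ≤ τ → 0 < P.V' τ
  concave : ∀ τ, 0 ≤ τ → P.pbar * P.lam ≤ -P.V'' τ / P.V' τ
  limit : ∃ Vinf : ℝ, Tendsto P.V atTop (𝓝 Vinf) ∧ P.c / P.mu < Vinf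

/-- A (full-effort) policy for the deadline `T`: `a τ` is the share of effort on the doing arm with
time `τ` remaining, absent an arrival; the share `1 - a τ` goes to the thinking arm. -/
def IsPolicy (T : ℝ) (a : ℝ → ℝ) : Prop :=
  Measurable a ∧ ∀ τ ∈ Icc 0 T, a τ ∈ Icc (0 : ℝ) 1

/-- Effort spent on the doing arm in the past, when time `τ` remains. -/
def pastDoing (T : ℝ) (a : ℝ → ℝ) (τ : ℝ) : ℝ := ∫ s in τ..T, a s

/-- Posterior belief that the doing arm is good, with time `τ` remaining and no arrival yet. -/
def belief (P : ThinkDo) (T : ℝ) (a : ℝ → ℝ) (τ : ℝ) : ℝ :=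
  P.pbar * Real.exp (-P.lam * pastDoing T a τ) /
    (P.pbar * Real.exp (-P.lam * pastDoing T a τ) + (1 - P.pbar))

/-- The agent's expected payoff from policy `a` under the deadline `T`: probability of no progress
yet, times probability of no solution yet, times expected flow payoff net of effort cost. -/
def payoff (P : ThinkDo) (T : ℝ) (a : ℝ → ℝ) : ℝ :=
  ∫ τ in (0 : ℝ)..T,
    Real.exp (-P.mu * (T - τ - pastDoing T a τ)) *
      (1 - P.pbar + P.pbar * Real.exp (-P.lam * pastDoing T a τ)) *
      (P.mu * (1 - a τ) * P.V τ + P.lam * a τ * P.belief T a τ * P.B - P.c)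

/-- `a` is an optimal policy for the deadline `T`. -/
def IsOptimal (P : ThinkDo) (T : ℝ) (a : ℝ → ℝ) : Prop :=
  IsPolicy T a ∧ ∀ b, IsPolicy T b → P.payoff T b ≤ P.payoff T a

/-- The policy `a` consists, in order of calendar time, of an initial doing period of length `τ₁`,
a thinking period of length `τ₂`, and a final doing period of length `τ₃` (recall that the argument
of `a` is the time remaining). If the agent never thinks, all doing counts as final doing. -/
structure HasPhases (T : ℝ) (a : ℝ → ℝ) (τ₁ τ₂ τ₃ : ℝ) : Prop where
  nonneg₁ : 0 ≤ τ₁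
  nonneg₂ : 0 ≤ τ₂
  nonneg₃ : 0 ≤ τ₃
  total : τ₁ + τ₂ + τ₃ = T
  only_doing : τ₂ = 0 → τ₁ = 0
  initial : ∀ᵐ τ, τ ∈ Ioo (τ₃ + τ₂) T → a τ = 1
  thinking : ∀ᵐ τ, τ ∈ Ioo τ₃ (τ₃ + τ₂) → a τ = 0
  final : ∀ᵐ τ, τ ∈ Ioo 0 τ₃ → a τ = 1

end ThinkDo

end

/-! The proof is an exchange argument, followed by a two-variable maximization. Let `x` be the doing
so far and `ρ = odds x` the inverse belief. Swapping adjacent bits of doing and thinking gains a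
positive multiple of `swapGain ρ τ`. The curvature hypothesis makes this nondecreasing in the
remaining time `τ` at every belief up to the prior, and a lower belief decreases it.

By `payoff_eq`, a policy earns what it would earn with all its doing moved to the front, less the
forgone gains `shiftGain`, one for each unit of doing. In `τ`, the forgone gain is an integral of
swap gains from `τ` up to `T - x`. It therefore rises and then falls, and its minimum over the
feasible times lies at an end: each unit is best done before all thinking or after all of it
(`min_shiftGain_le`). As `x` grows, the choice switches once from early to late
(`shiftGain_line_nonpos`), so do-think-do dominates. Strict inequalities after some doing force
every optimum into this shape.

What remains is to maximize `reward T x z` over a compact triangle. An optimum with thinking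
satisfies the first-order conditions `IsCandidate`. Between two candidates, a larger `x` goes with a
smaller `z`, a larger `y` and a larger `T`; this gives both uniqueness and monotonicity
(`IsCandidate.mono`). Once thinking pays for one deadline, it pays for all later ones. Finally `x`
and `z` are bounded uniformly over candidates, so `y` absorbs all additional time. -/

noncomputable section

namespace ThinkDo

/-! ### The value of progress on the whole line, and its curvature. -/

variable {P : ThinkDo}

/-- The value of progress, extended affinely (and continuously differentiably) to negative times. -/
def val (P : ThinkDo) (τ : ℝ) : ℝ := P.V (max τ 0) + P.V' 0 * min τ 0

/-- The derivative of the extended value of progress. -/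
def val' (P : ThinkDo) (τ : ℝ) : ℝ := P.V' (max τ 0)

lemma val_of_nonneg {τ : ℝ} (h : 0 ≤ τ) : P.val τ = P.V τ := by
  simp [val, h]

lemma Standing.contDiffOn_V' (hP : P.Standing) : ContDiffOn ℝ 2 P.V' (Ici 0) :=
  hP.smooth.derivWithin (uniqueDiffOn_Ici 0) (by norm_num)

lemma Standing.hasDerivWithinAt_V (hP : P.Standing) {τ : ℝ} (h : 0 ≤ τ) :
    HasDerivWithinAt P.V (P.V' τ) (Ici 0) τ :=
  (hP.smooth.differentiableOn (by norm_num) τ h).hasDerivWithinAt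

lemma Standing.hasDerivWithinAt_V' (hP : P.Standing) {τ : ℝ} (h : 0 ≤ τ) :
    HasDerivWithinAt P.V' (P.V'' τ) (Ici 0) τ :=
  (hP.contDiffOn_V'.differentiableOn (by norm_num) τ h).hasDerivWithinAt

lemma Standing.continuous_val' (hP : P.Standing) : Continuous P.val' :=
  hP.contDiffOn_V'.continuousOn.comp_continuous (by fun_prop) (fun τ => le_max_right τ 0)

lemma Standing.val'_pos (hP : P.Standing) (τ : ℝ) : 0 < P.val' τ :=
  hP.increasing _ (le_max_right τ 0)

/-- The affine continuation has slope `V' 0`, so the one-sided derivatives agree at `0`, and later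
calculus needs no boundary cases. -/
lemma Standing.hasDerivAt_val (hP : P.Standing) (τ : ℝ) : HasDerivAt P.val (P.val' τ) τ := by
  have right : ∀ σ : ℝ, 0 ≤ σ → HasDerivWithinAt P.val (P.val' σ) (Ici 0) σ := fun σ hσ => by
    have := hP.hasDerivWithinAt_V hσ
    simp only [val', max_eq_left hσ]
    exact this.congr (fun x hx => val_of_nonneg hx) (val_of_nonneg hσ)
  have left : ∀ σ : ℝ, σ ≤ 0 → HasDerivWithinAt P.val (P.val' σ) (Iic 0) σ := fun σ hσ => by
    have : HasDerivWithinAt (fun x => P.V 0 + P.V' 0 * x) (P.V' 0) (Iic 0) σ := by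
      simpa using (((hasDerivAt_id σ).const_mul (P.V' 0)).const_add (P.V 0)).hasDerivWithinAt
    simp only [val', max_eq_right hσ]
    have key : ∀ x ∈ Iic (0 : ℝ), P.val x = P.V 0 + P.V' 0 * x := fun x hx => by
      simp [val, max_eq_right (mem_Iic.1 hx), min_eq_left (mem_Iic.1 hx)]
    exact this.congr key (key σ hσ)
  rcases lt_trichotomy τ 0 with h | rfl | h
  · exact (left τ h.le).hasDerivAt (Iic_mem_nhds h)
  · have := (left 0 le_rfl).union (right 0 le_rfl)
    rwa [Iic_union_Ici, hasDerivWithinAt_univ] at this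
  · exact (right τ h.le).hasDerivAt (Ici_mem_nhds h)

lemma Standing.continuous_val (hP : P.Standing) : Continuous P.val :=
  continuous_iff_continuousAt.2 fun τ => (hP.hasDerivAt_val τ).continuousAt

lemma Standing.strictMono_val (hP : P.Standing) : StrictMono P.val :=
  strictMono_of_hasDerivAt_pos hP.hasDerivAt_val hP.val'_pos

lemma Standing.val_zero (hP : P.Standing) : P.val 0 = 0 := by
  rw [val_of_nonneg le_rfl, hP.V_zero]

lemma Standing.val_nonneg (hP : P.Standing) {τ : ℝ} (h : 0 ≤ τ) : 0 ≤ P.val τ := by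
  rw [← hP.val_zero]; exact hP.strictMono_val.monotone h

lemma Standing.pbar_pos (hP : P.Standing) : 0 < P.pbar := hP.pbar_mem.1

lemma Standing.pbar_lt_one (hP : P.Standing) : P.pbar < 1 := hP.pbar_mem.2

lemma Standing.V''_le (hP : P.Standing) {τ : ℝ} (h : 0 ≤ τ) :
    P.V'' τ ≤ -(P.pbar * P.lam * P.V' τ) := by
  have h1 := hP.concave τ h
  rw [le_div_iff₀ (hP.increasing τ h)] at h1
  linarith

lemma Standing.hasDerivWithinAt_potential (hP : P.Standing) (ρ : ℝ) {τ : ℝ}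
    (hτ : τ ∈ interior (Ici (0 : ℝ))) :
    HasDerivWithinAt (fun τ => P.val τ + ρ / P.lam * P.val' τ)
      (P.V' τ + ρ / P.lam * P.V'' τ) (interior (Ici 0)) τ := by
  rw [interior_Ici] at hτ ⊢
  have h0 : (0 : ℝ) ≤ τ := le_of_lt hτ
  have h1 := ((hP.hasDerivWithinAt_V h0).add ((hP.hasDerivWithinAt_V' h0).const_mul
    (ρ / P.lam))).mono Ioi_subset_Ici_self
  have key : ∀ x ∈ Ici (0 : ℝ), P.val x + ρ / P.lam * P.val' x
      = (P.V + fun y => ρ / P.lam * P.V' y) x := fun x hx => by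
    simp only [val_of_nonneg (mem_Ici.1 hx), val', max_eq_left (mem_Ici.1 hx), Pi.add_apply]
  exact h1.congr (fun x hx => key x (le_of_lt (mem_Ioi.1 hx))) (key τ h0)

/-- The derivative `V' + (ρ / lam) V''` is at most `(1 - pbar * ρ) V'`, by the curvature hypothesis.
Up to the factor `-mu`, this function is the time-dependent part of `swapGain`. -/
lemma Standing.antitoneOn_potential (hP : P.Standing) {ρ : ℝ} (hρ : 1 ≤ P.pbar * ρ) :
    AntitoneOn (fun τ => P.val τ + ρ / P.lam * P.val' τ) (Ici 0) := by
  have c1 := hP.continuous_val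
  have c2 := hP.continuous_val'
  refine antitoneOn_of_hasDerivWithinAt_nonpos (convex_Ici 0) (by fun_prop)
    (fun x hx => hP.hasDerivWithinAt_potential ρ hx) fun x hx => ?_
  have hx0 : (0 : ℝ) ≤ x := interior_subset hx
  have hρ0 : 0 < ρ := by
    by_contra! h
    nlinarith [hP.pbar_pos]
  have h1 := mul_le_mul_of_nonneg_left (hP.V''_le hx0) (div_pos hρ0 hP.lam_pos).le
  have h2 : ρ / P.lam * -(P.pbar * P.lam * P.V' x) = -(P.pbar * ρ * P.V' x) := by
    field_simp [hP.lam_pos.ne']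
  nlinarith [hP.increasing x hx0]

lemma Standing.strictAntiOn_potential (hP : P.Standing) {ρ : ℝ} (hρ : 1 < P.pbar * ρ) :
    StrictAntiOn (fun τ => P.val τ + ρ / P.lam * P.val' τ) (Ici 0) := by
  have c1 := hP.continuous_val
  have c2 := hP.continuous_val'
  refine strictAntiOn_of_hasDerivWithinAt_neg (convex_Ici 0) (by fun_prop)
    (fun x hx => hP.hasDerivWithinAt_potential ρ hx) fun x hx => ?_
  have hx0 : (0 : ℝ) ≤ x := interior_subset hx
  have hρ0 : 0 < ρ := by
    by_contra! h
    nlinarith [hP.pbar_pos]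
  have h1 := mul_le_mul_of_nonneg_left (hP.V''_le hx0) (div_pos hρ0 hP.lam_pos).le
  have h2 : ρ / P.lam * -(P.pbar * P.lam * P.V' x) = -(P.pbar * ρ * P.V' x) := by
    field_simp [hP.lam_pos.ne']
  nlinarith [hP.increasing x hx0]

/-! ### Closed forms for doing and thinking, and the swap gain. -/

/-- Probability that the doing arm is good and has not delivered after doing for a time `x`. -/
def good (P : ThinkDo) (x : ℝ) : ℝ := P.pbar * Real.exp (-P.lam * x)

/-- Probability that no solution has arrived after doing for a time `x`. -/
def surv (P : ThinkDo) (x : ℝ) : ℝ := 1 - P.pbar + P.good x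

/-- The inverse of the belief after doing for a time `x`. -/
def odds (P : ThinkDo) (x : ℝ) : ℝ := 1 + (1 - P.pbar) / P.pbar * Real.exp (P.lam * x)

/-- Unnormalized flow payoff of doing. -/
def doRate (P : ThinkDo) (x : ℝ) : ℝ := P.lam * P.B * P.good x - P.c * P.surv x

/-- Payoff of doing for a time `x`. -/
def doVal (P : ThinkDo) (x : ℝ) : ℝ :=
  (P.B - P.c / P.lam) * (P.pbar - P.good x) - (1 - P.pbar) * P.c * x

/-- The integrand of `thinkVal`. -/
def thinkRate (P : ThinkDo) (u : ℝ) : ℝ := Real.exp (P.mu * u) * (P.mu * P.val u - P.c)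

/-- Accumulated payoff of thinking, discounted to the deadline. -/
def thinkVal (P : ThinkDo) (u : ℝ) : ℝ := ∫ r in (0 : ℝ)..u, P.thinkRate r

/-- Marginal gain from doing before rather than after thinking, at inverse belief `ρ` and with
time `τ` remaining. -/
def swapGain (P : ThinkDo) (ρ τ : ℝ) : ℝ :=
  P.mu * (P.B - P.val τ) + P.c - P.mu / P.lam * ρ * (P.val' τ + P.c)

lemma Standing.good_pos (hP : P.Standing) (x : ℝ) : 0 < P.good x :=
  mul_pos hP.pbar_pos (Real.exp_pos _)

lemma Standing.surv_pos (hP : P.Standing) (x : ℝ) : 0 < P.surv x := by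
  have := hP.good_pos x
  have := hP.pbar_lt_one
  unfold surv; linarith

lemma good_zero : P.good 0 = P.pbar := by simp [good]

lemma surv_zero : P.surv 0 = 1 := by simp [surv, good_zero]

lemma doVal_zero : P.doVal 0 = 0 := by simp [doVal, good_zero]

lemma Standing.surv_eq (hP : P.Standing) (x : ℝ) : P.surv x = P.good x * P.odds x := by
  have := hP.pbar_pos.ne'
  have h : Real.exp (-(P.lam * x)) * Real.exp (P.lam * x) = 1 := by
    rw [← Real.exp_add]; simp
  simp only [surv, odds, good, neg_mul]
  field_simp
  linear_combination (-(1 - P.pbar)) * h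

/-- Without an arrival the belief never exceeds the prior, so a curvature bound stated at the prior
serves at every later belief. -/
lemma Standing.one_le_odds (hP : P.Standing) {x : ℝ} (hx : 0 ≤ x) : 1 ≤ P.pbar * P.odds x := by
  have h0 := hP.pbar_pos
  have h1 := hP.pbar_lt_one
  have h2 : 1 ≤ Real.exp (P.lam * x) := Real.one_le_exp (mul_nonneg hP.lam_pos.le hx)
  have h3 : P.pbar * P.odds x = P.pbar + (1 - P.pbar) * Real.exp (P.lam * x) := by
    unfold odds; field_simp
  nlinarith

lemma Standing.strictMono_odds (hP : P.Standing) : StrictMono P.odds := by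
  intro x y h
  have h0 := hP.pbar_pos
  have h1 := sub_pos.2 hP.pbar_lt_one
  have h2 : P.lam * x < P.lam * y := mul_lt_mul_of_pos_left h hP.lam_pos
  unfold odds
  gcongr

lemma Standing.odds_zero (hP : P.Standing) : P.pbar * P.odds 0 = 1 := by
  have := hP.pbar_pos.ne'
  simp only [odds, mul_zero, Real.exp_zero]; field_simp; ring

lemma Standing.one_lt_odds (hP : P.Standing) {x : ℝ} (hx : 0 < x) : 1 < P.pbar * P.odds x := by
  rw [← hP.odds_zero]
  exact mul_lt_mul_of_pos_left (hP.strictMono_odds hx) hP.pbar_pos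

lemma hasDerivAt_good (x : ℝ) : HasDerivAt P.good (-P.lam * P.good x) x := by
  have := (((hasDerivAt_id x).const_mul (-P.lam)).exp).const_mul P.pbar
  exact this.congr_deriv (by simp only [good, id]; ring)

lemma hasDerivAt_surv (x : ℝ) : HasDerivAt P.surv (-P.lam * P.good x) x :=
  (hasDerivAt_good x).const_add (1 - P.pbar)

lemma Standing.hasDerivAt_doVal (hP : P.Standing) (x : ℝ) : HasDerivAt P.doVal (P.doRate x) x := by
  have h1 := ((hasDerivAt_good (P := P) x).const_sub P.pbar).const_mul (P.B - P.c / P.lam)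
  have h2 := (hasDerivAt_id x).const_mul ((1 - P.pbar) * P.c)
  have := hP.lam_pos.ne'
  refine (h1.sub h2).congr_deriv ?_
  simp only [doRate, surv]
  field_simp; ring

lemma Standing.continuous_thinkRate (hP : P.Standing) : Continuous P.thinkRate := by
  have := hP.continuous_val
  unfold thinkRate
  fun_prop

lemma Standing.hasDerivAt_thinkVal (hP : P.Standing) (u : ℝ) :
    HasDerivAt P.thinkVal (P.thinkRate u) u :=
  (hP.continuous_thinkRate.integral_hasStrictDerivAt 0 u).hasDerivAt

lemma Standing.hasDerivAt_thinkRate (hP : P.Standing) (u : ℝ) :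
    HasDerivAt P.thinkRate
      (Real.exp (P.mu * u) * (P.mu * (P.mu * P.val u - P.c) + P.mu * P.val' u)) u := by
  have h1 := ((hasDerivAt_id u).const_mul P.mu).exp
  have h2 := ((hP.hasDerivAt_val u).const_mul P.mu).sub_const P.c
  refine (h1.mul h2).congr_deriv ?_
  simp only [id]; ring

@[fun_prop]
lemma continuous_good : Continuous P.good := by unfold good; fun_prop

@[fun_prop]
lemma continuous_surv : Continuous P.surv := by unfold surv; fun_prop

@[fun_prop]
lemma continuous_odds : Continuous P.odds := by unfold odds; fun_prop

@[fun_prop]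
lemma continuous_doVal : Continuous P.doVal := by unfold doVal; fun_prop

@[fun_prop]
lemma continuous_doRate : Continuous P.doRate := by unfold doRate; fun_prop

lemma Standing.continuous_thinkVal (hP : P.Standing) : Continuous P.thinkVal :=
  continuous_iff_continuousAt.2 fun u => (hP.hasDerivAt_thinkVal u).continuousAt

lemma Standing.continuous_swapGain (hP : P.Standing) :
    Continuous fun q : ℝ × ℝ => P.swapGain q.1 q.2 := by
  have c1 := hP.continuous_val
  have c2 := hP.continuous_val'
  unfold swapGain; fun_prop

lemma swapGain_eq (ρ τ : ℝ) :
    P.swapGain ρ τ = P.mu * P.B + P.c - P.mu / P.lam * ρ * P.c -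
      P.mu * (P.val τ + ρ / P.lam * P.val' τ) := by
  unfold swapGain; ring

lemma Standing.monotoneOn_swapGain (hP : P.Standing) {ρ : ℝ} (hρ : 1 ≤ P.pbar * ρ) :
    MonotoneOn (P.swapGain ρ) (Ici 0) := by
  intro s hs t ht h
  have := mul_le_mul_of_nonneg_left (hP.antitoneOn_potential hρ hs ht h) hP.mu_pos.le
  simp only [swapGain_eq]
  linarith

lemma Standing.strictMonoOn_swapGain (hP : P.Standing) {ρ : ℝ} (hρ : 1 < P.pbar * ρ) :
    StrictMonoOn (P.swapGain ρ) (Ici 0) := by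
  intro s hs t ht h
  have := mul_lt_mul_of_pos_left (hP.strictAntiOn_potential hρ hs ht h) hP.mu_pos
  simp only [swapGain_eq]
  linarith

lemma Standing.swapGain_lt_of_lt (hP : P.Standing) {ρ ρ' : ℝ} (h : ρ < ρ') (τ : ℝ) :
    P.swapGain ρ' τ < P.swapGain ρ τ := by
  have h1 := hP.val'_pos τ
  have h2 := hP.c_pos
  have h3 : 0 < P.mu / P.lam := div_pos hP.mu_pos hP.lam_pos
  unfold swapGain
  have : P.mu / P.lam * ρ * (P.val' τ + P.c) < P.mu / P.lam * ρ' * (P.val' τ + P.c) := by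
    gcongr
  linarith

end ThinkDo

/-! ### Absolute continuity, and cumulative doing as a Lipschitz clock. -/

lemma contDiff_one_of_hasDerivAt {f f' : ℝ → ℝ} (h : ∀ x, HasDerivAt f (f' x) x)
    (hf' : Continuous f') : ContDiff ℝ 1 f := by
  rw [contDiff_one_iff_deriv]
  refine ⟨fun x => (h x).differentiableAt, ?_⟩
  have : deriv f = f' := funext fun x => (h x).deriv
  rwa [this]

/-- The image of `g` lies in a compact interval, on which `f` is Lipschitz. -/
lemma ContDiff.absolutelyContinuousOnInterval_comp {f g : ℝ → ℝ} {a b : ℝ} {K : NNReal}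
    (hf : ContDiff ℝ 1 f) (hg : LipschitzOnWith K g (uIcc a b)) :
    AbsolutelyContinuousOnInterval (fun x => f (g x)) a b := by
  have him : IsCompact (g '' uIcc a b) := isCompact_uIcc.image_of_continuousOn hg.continuousOn
  obtain ⟨m, hm⟩ := him.bddBelow
  obtain ⟨M, hM⟩ := him.bddAbove
  obtain ⟨C, hC⟩ := (hf.contDiffOn (s := Icc m M)).exists_lipschitzOnWith (by decide)
    (convex_Icc _ _) isCompact_Icc
  have hmaps : MapsTo g (uIcc a b) (Icc m M) := fun x hx =>
    ⟨hm (mem_image_of_mem g hx), hM (mem_image_of_mem g hx)⟩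
  exact (hC.comp hg hmaps).absolutelyContinuousOnInterval

namespace ThinkDo

variable {P : ThinkDo}

section Policy

variable {T : ℝ} {a : ℝ → ℝ}

lemma IsPolicy.intervalIntegrable (ha : IsPolicy T a) {s t : ℝ} (hs : s ∈ Icc 0 T)
    (ht : t ∈ Icc 0 T) : IntervalIntegrable a volume s t := by
  have hsub : uIcc s t ⊆ Icc 0 T := uIcc_subset_Icc hs ht
  refine (intervalIntegrable_const (c := (1 : ℝ))).mono_fun ha.1.aestronglyMeasurable ?_
  refine (ae_restrict_iff' measurableSet_uIoc).2 (.of_forall fun x hx => ?_)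
  have := ha.2 x (hsub (uIoc_subset_uIcc hx))
  simpa [abs_of_nonneg this.1] using this.2

lemma IsPolicy.pastDoing_sub (ha : IsPolicy T a) {s t : ℝ} (hs : s ∈ Icc 0 T)
    (ht : t ∈ Icc 0 T) : pastDoing T a s - pastDoing T a t = ∫ r in s..t, a r := by
  have hT : T ∈ Icc 0 T := ⟨hs.1.trans hs.2, le_rfl⟩
  have := intervalIntegral.integral_add_adjacent_intervals (ha.intervalIntegrable hs ht)
    (ha.intervalIntegrable ht hT)
  unfold pastDoing; linarith

lemma pastDoing_self : pastDoing T a T = 0 := by simp [pastDoing]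

lemma IsPolicy.pastDoing_sub_mem (ha : IsPolicy T a) {s t : ℝ} (hs : 0 ≤ s) (hst : s ≤ t)
    (ht : t ≤ T) : pastDoing T a s - pastDoing T a t ∈ Icc 0 (t - s) := by
  rw [ha.pastDoing_sub ⟨hs, hst.trans ht⟩ ⟨hs.trans hst, ht⟩]
  have hm : ∀ u ∈ Icc s t, a u ∈ Icc (0 : ℝ) 1 := fun u hu =>
    ha.2 u ⟨hs.trans hu.1, hu.2.trans ht⟩
  refine ⟨intervalIntegral.integral_nonneg hst fun u hu => (hm u hu).1, ?_⟩
  have := intervalIntegral.integral_mono_on hst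
    (ha.intervalIntegrable ⟨hs, hst.trans ht⟩ ⟨hs.trans hst, ht⟩)
    (intervalIntegrable_const (c := (1 : ℝ))) fun u hu => (hm u hu).2
  simpa using this

lemma IsPolicy.pastDoing_mem (ha : IsPolicy T a) {s : ℝ} (hs : s ∈ Icc 0 T) :
    pastDoing T a s ∈ Icc 0 (T - s) := by
  simpa [pastDoing_self] using ha.pastDoing_sub_mem hs.1 hs.2 le_rfl

lemma IsPolicy.lipschitzOnWith_pastDoing (ha : IsPolicy T a) :
    LipschitzOnWith 1 (pastDoing T a) (Icc 0 T) := by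
  refine LipschitzOnWith.of_dist_le_mul fun s hs t ht => ?_
  simp only [NNReal.coe_one, one_mul, Real.dist_eq]
  rcases le_total s t with h | h
  · have := ha.pastDoing_sub_mem hs.1 h ht.2
    rw [abs_of_nonneg this.1, abs_sub_comm, abs_of_nonneg (sub_nonneg.2 h)]
    exact this.2
  · have := ha.pastDoing_sub_mem ht.1 h hs.2
    rw [abs_sub_comm, abs_of_nonneg this.1, abs_of_nonneg (sub_nonneg.2 h)]
    exact this.2

lemma IsPolicy.ae_hasDerivAt_pastDoing (ha : IsPolicy T a) (hT : 0 ≤ T) :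
    ∀ᵐ τ, τ ∈ Icc 0 T → HasDerivAt (pastDoing T a) (-a τ) τ := by
  have h := (ha.intervalIntegrable (left_mem_Icc.2 hT)
    (right_mem_Icc.2 hT)).ae_hasDerivAt_integral
  filter_upwards [h] with τ hτ hmem
  rw [uIcc_of_le hT] at hτ
  have := (hτ hmem T (right_mem_Icc.2 hT)).neg
  refine this.congr_of_eventuallyEq (.of_forall fun s => ?_)
  simp only [pastDoing, Pi.neg_apply]
  rw [intervalIntegral.integral_symm]

/-- Change of variables `x = pastDoing T a τ`, `dx = -a τ dτ`: a quantity charged per unit of doing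
does not depend on when the doing takes place. -/
lemma IsPolicy.integral_mul_comp_pastDoing (ha : IsPolicy T a) (hT : 0 ≤ T) {m : ℝ → ℝ}
    (hm : Continuous m) :
    ∫ τ in (0 : ℝ)..T, a τ * m (pastDoing T a τ) = ∫ x in (0 : ℝ)..pastDoing T a 0, m x := by
  set M : ℝ → ℝ := fun x => ∫ r in (0 : ℝ)..x, m r with hM
  have hM' : ∀ x, HasDerivAt M (m x) x := fun x => (hm.integral_hasStrictDerivAt 0 x).hasDerivAt
  have hL := ha.lipschitzOnWith_pastDoing
  rw [← uIcc_of_le hT] at hL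
  have hac := (contDiff_one_of_hasDerivAt hM' hm).absolutelyContinuousOnInterval_comp hL
  have h := hac.integral_deriv_eq_sub
  have hcongr : ∫ τ in (0 : ℝ)..T, deriv (fun x => M (pastDoing T a x)) τ
      = ∫ τ in (0 : ℝ)..T, -(a τ * m (pastDoing T a τ)) := by
    refine intervalIntegral.integral_congr_ae ?_
    filter_upwards [ha.ae_hasDerivAt_pastDoing hT] with τ hτ hmem
    rw [uIoc_of_le hT] at hmem
    have hd : HasDerivAt (fun x => M (pastDoing T a x)) (m (pastDoing T a τ) * -a τ) τ :=
      (hM' _).comp τ (hτ (Ioc_subset_Icc_self hmem))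
    rw [hd.deriv]
    ring
  rw [hcongr, intervalIntegral.integral_neg, pastDoing_self] at h
  have h0 : M 0 = 0 := by simp [hM]
  rw [h0] at h
  linarith

end Policy

/-! ### The payoff as a front-loaded reward less forgone gains. -/

/-- Payoff from doing for a time `x`, then thinking until time `z` remains, then doing. -/
def reward (P : ThinkDo) (T x z : ℝ) : ℝ :=
  P.doVal x + P.surv x * Real.exp (-P.mu * (T - x)) * (P.thinkVal (T - x) - P.thinkVal z) +
    Real.exp (-P.mu * (T - x - z)) * (P.doVal (x + z) - P.doVal x)

/-- Marginal gain from moving a whole past thinking period behind a marginal unit of doing. -/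
def shiftGain (P : ThinkDo) (T x τ : ℝ) : ℝ :=
  P.doRate x * (1 - Real.exp (-P.mu * (T - x - τ))) +
    Real.exp (-P.mu * (T - x)) *
      ((P.mu * P.surv x - P.lam * P.good x) * (P.thinkVal (T - x) - P.thinkVal τ) -
        P.surv x * (P.thinkRate (T - x) - P.thinkRate τ))

/-- Swap gains accumulated between the times `s` and `t`, discounted to the deadline. -/
def swapInt (P : ThinkDo) (ρ s t : ℝ) : ℝ :=
  ∫ r in s..t, Real.exp (P.mu * r) * P.swapGain ρ r

lemma Standing.continuousOn_shiftGain_comp (hP : P.Standing) (T : ℝ) {X : ℝ → ℝ} {s : Set ℝ}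
    (hX : ContinuousOn X s) : ContinuousOn (fun τ => P.shiftGain T (X τ) τ) s := by
  have c1 := hP.continuous_thinkVal
  have c2 := hP.continuous_thinkRate
  unfold shiftGain; fun_prop

lemma Standing.continuous_reward (hP : P.Standing) (T : ℝ) :
    Continuous fun q : ℝ × ℝ => P.reward T q.1 q.2 := by
  have c1 := hP.continuous_thinkVal
  unfold reward; fun_prop

lemma Standing.continuous_swapIntegrand (hP : P.Standing) (ρ : ℝ) :
    Continuous fun r => Real.exp (P.mu * r) * P.swapGain ρ r := by
  have := hP.continuous_swapGain
  have h2 : Continuous fun r => P.swapGain ρ r := this.comp (Continuous.prodMk_right ρ)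
  fun_prop

/-- Both sides vanish at `τ = T - x` and have the same derivative in `τ`: passing a block of
thinking amounts to passing its infinitesimal pieces one by one. -/
lemma Standing.shiftGain_eq (hP : P.Standing) (T x τ : ℝ) :
    P.shiftGain T x τ =
      P.lam * P.good x * Real.exp (-P.mu * (T - x)) * P.swapInt (P.odds x) τ (T - x) := by
  have hd : ∀ r, HasDerivAt (fun r => P.shiftGain T x r) (-(P.lam * P.good x *
      Real.exp (-P.mu * (T - x))) * (Real.exp (P.mu * r) * P.swapGain (P.odds x) r)) r := by
    intro r
    have h1 := ((((hasDerivAt_id r).const_sub (T - x)).const_mul (-P.mu)).exp.const_sub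
      1).const_mul (P.doRate x)
    have h2 := (((hP.hasDerivAt_thinkVal r).const_sub (P.thinkVal (T - x))).const_mul
      (P.mu * P.surv x - P.lam * P.good x)).sub
      (((hP.hasDerivAt_thinkRate r).const_sub (P.thinkRate (T - x))).const_mul (P.surv x))
    refine (h1.add (h2.const_mul (Real.exp (-P.mu * (T - x))))).congr_deriv ?_
    have he : Real.exp (-P.mu * (T - x - r)) = Real.exp (-P.mu * (T - x)) * Real.exp (P.mu * r) := by
      rw [← Real.exp_add]; ring_nf
    have hl := hP.lam_pos.ne'
    simp only [id, he, doRate, thinkRate, swapGain, hP.surv_eq]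
    field_simp
    ring
  have := intervalIntegral.integral_eq_sub_of_hasDerivAt (a := τ) (b := T - x)
    (fun r _ => hd r) (((hP.continuous_swapIntegrand _).const_mul _).intervalIntegrable _ _)
  rw [intervalIntegral.integral_const_mul] at this
  have h0 : P.shiftGain T x (T - x) = 0 := by simp [shiftGain]
  rw [h0] at this
  unfold swapInt
  linarith

lemma Standing.payoff_integrand (hP : P.Standing) (T : ℝ) (a : ℝ → ℝ) {τ : ℝ} (hτ : 0 ≤ τ) :
    Real.exp (-P.mu * (T - τ - pastDoing T a τ)) *
      (1 - P.pbar + P.pbar * Real.exp (-P.lam * pastDoing T a τ)) *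
      (P.mu * (1 - a τ) * P.V τ + P.lam * a τ * P.belief T a τ * P.B - P.c) =
    Real.exp (-P.mu * (T - τ - pastDoing T a τ)) *
      (P.surv (pastDoing T a τ) * (1 - a τ) * (P.mu * P.val τ - P.c) +
        a τ * P.doRate (pastDoing T a τ)) := by
  set x := pastDoing T a τ with hx
  have hs : 1 - P.pbar + P.pbar * Real.exp (-P.lam * x) = P.surv x := rfl
  have hb : P.belief T a τ = P.good x / P.surv x := by
    simp only [belief, surv, good, ← hx, add_comm]
  have := (hP.surv_pos x).ne'
  rw [hs, hb, val_of_nonneg hτ, doRate]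
  field_simp
  ring

/-- The payoff of a policy is that of first doing and then thinking for the same total times, less
the gains forgone by not doing earlier. -/
lemma Standing.payoff_eq (hP : P.Standing) {T : ℝ} (hT : 0 ≤ T) {a : ℝ → ℝ} (ha : IsPolicy T a) :
    P.payoff T a = P.reward T (pastDoing T a 0) 0 -
      ∫ τ in (0 : ℝ)..T, a τ * P.shiftGain T (pastDoing T a τ) τ := by
  have hL := ha.lipschitzOnWith_pastDoing
  rw [← uIcc_of_le hT] at hL
  set X := pastDoing T a with hX
  set g : ℝ → ℝ := fun x => P.surv x * Real.exp (-P.mu * (T - x)) with hg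
  set g' : ℝ → ℝ := fun x =>
    (P.mu * P.surv x - P.lam * P.good x) * Real.exp (-P.mu * (T - x)) with hg'
  have hdg : ∀ x, HasDerivAt g (g' x) x := fun x => by
    have h1 := (((hasDerivAt_id x).const_sub T).const_mul (-P.mu)).exp
    refine ((hasDerivAt_surv x).mul h1).congr_deriv ?_
    simp only [hg', id]; ring
  set f : ℝ → ℝ := fun x => P.doVal x + g x * P.thinkVal (T - x) with hf
  set f' : ℝ → ℝ := fun x => P.doRate x + (g' x * P.thinkVal (T - x) -
    g x * P.thinkRate (T - x)) with hf'
  have hdf : ∀ x, HasDerivAt f (f' x) x := fun x => by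
    have h1 : HasDerivAt (fun x => P.thinkVal (T - x)) (P.thinkRate (T - x) * -1) x :=
      (hP.hasDerivAt_thinkVal (T - x)).comp x ((hasDerivAt_id x).const_sub T)
    refine ((hP.hasDerivAt_doVal x).add ((hdg x).mul h1)).congr_deriv ?_
    simp only [hf']; ring
  have c1 := hP.continuous_thinkVal
  have c2 := hP.continuous_thinkRate
  have hcg : Continuous g := by fun_prop
  have hcg' : Continuous g' := by fun_prop
  have hcf' : Continuous f' := by fun_prop
  have hacf := (contDiff_one_of_hasDerivAt hdf hcf').absolutelyContinuousOnInterval_comp hL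
  have hacg := (contDiff_one_of_hasDerivAt hdg hcg').absolutelyContinuousOnInterval_comp hL
  have hacI := (contDiff_one_of_hasDerivAt hP.hasDerivAt_thinkVal c2).contDiffOn
    (s := uIcc 0 T) |>.absolutelyContinuousOnInterval
  -- This potential is the payoff accrued by the time `τ` remains if all doing so far is moved ahead
  -- of all thinking so far. The actual flow payoff is minus its `τ`-derivative, less `a τ` times
  -- `shiftGain`; it vanishes at `τ = T` and is `reward T (X 0) 0` at `τ = 0`.
  have hac := hacf.sub (hacg.mul hacI)
  have hint := hac.intervalIntegrable_deriv
  have hsub := hac.integral_deriv_eq_sub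
  have hXc : ContinuousOn X (uIcc 0 T) := hL.continuousOn
  have hsc : ContinuousOn (fun τ => P.shiftGain T (X τ) τ) (uIcc 0 T) :=
    hP.continuousOn_shiftGain_comp T hXc
  have hai := ha.intervalIntegrable (left_mem_Icc.2 hT) (right_mem_Icc.2 hT)
  have hint2 : IntervalIntegrable (fun τ => a τ * P.shiftGain T (X τ) τ) volume 0 T :=
    hai.mul_continuousOn hsc
  have hpay : P.payoff T a = ∫ τ in (0 : ℝ)..T, ((-deriv ((fun x => f (X x)) -
      (fun x => g (X x)) * P.thinkVal)) τ - a τ * P.shiftGain T (X τ) τ) := by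
    unfold payoff
    refine intervalIntegral.integral_congr_ae ?_
    filter_upwards [ha.ae_hasDerivAt_pastDoing hT] with τ hτ hmem
    rw [uIoc_of_le hT] at hmem
    have hX' := hτ (Ioc_subset_Icc_self hmem)
    rw [hP.payoff_integrand T a hmem.1.le, ← hX]
    have e1 : HasDerivAt (fun x => f (X x)) (f' (X τ) * -a τ) τ := (hdf (X τ)).comp τ hX'
    have e2 : HasDerivAt (fun x => g (X x)) (g' (X τ) * -a τ) τ := (hdg (X τ)).comp τ hX'
    rw [Pi.neg_apply, (e1.sub (e2.mul (hP.hasDerivAt_thinkVal τ))).deriv]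
    have he : Real.exp (-P.mu * (T - τ - X τ)) =
        Real.exp (-P.mu * (T - X τ)) * Real.exp (P.mu * τ) := by
      rw [← Real.exp_add]; ring_nf
    have he' : Real.exp (-P.mu * (T - X τ - τ)) =
        Real.exp (-P.mu * (T - X τ)) * Real.exp (P.mu * τ) := by
      rw [← Real.exp_add]; ring_nf
    simp only [shiftGain, hf', hg, hg', he, he']
    rw [show P.thinkRate τ = Real.exp (P.mu * τ) * (P.mu * P.val τ - P.c) from rfl]
    ring
  rw [hpay, intervalIntegral.integral_sub hint.neg hint2]
  simp only [Pi.neg_apply]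
  rw [intervalIntegral.integral_neg, hsub]
  have hXT : X T = 0 := pastDoing_self
  simp only [Pi.sub_apply, Pi.mul_apply, hXT, reward, hf, hg, surv_zero, doVal_zero, sub_zero,
    add_zero, sub_self, mul_zero]
  ring

end ThinkDo

lemma exists_sign_switch {f : ℝ → ℝ} {w : ℝ} (hw : 0 ≤ w) (hf : Continuous f)
    (h : ∀ x ∈ Icc 0 w, ∀ y ∈ Icc 0 w, x ≤ y → f x ≤ 0 → f y ≤ 0) :
    ∃ c ∈ Icc 0 w, (∀ x ∈ Ico 0 c, 0 ≤ f x) ∧ ∀ x ∈ Ioc c w, f x ≤ 0 := by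
  by_cases hne : (Icc 0 w ∩ f ⁻¹' Iic 0).Nonempty
  · obtain ⟨c, ⟨hc, hfc⟩, hleast⟩ :=
      (isCompact_Icc.inter_right (isClosed_Iic.preimage hf)).exists_isLeast hne
    refine ⟨c, hc, fun x hx => ?_, fun x hx => h c hc x ⟨hc.1.trans hx.1.le, hx.2⟩ hx.1.le hfc⟩
    by_contra! hlt
    exact hx.2.not_ge (hleast ⟨⟨hx.1, hx.2.le.trans hc.2⟩, hlt.le⟩)
  · refine ⟨w, right_mem_Icc.2 hw, fun x hx => ?_, fun x hx => absurd hx.1 hx.2.not_gt⟩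
    by_contra! hlt
    exact hne ⟨x, ⟨hx.1, hx.2.le⟩, hlt.le⟩

namespace ThinkDo

variable {P : ThinkDo}

/-! ### Signs and comparison of accumulated swap gains. -/

section SwapInt

variable {ρ ρ' s t d : ℝ}

lemma Standing.swapInt_add (hP : P.Standing) (ρ s t r : ℝ) :
    P.swapInt ρ s t + P.swapInt ρ t r = P.swapInt ρ s r :=
  intervalIntegral.integral_add_adjacent_intervals
    ((hP.continuous_swapIntegrand ρ).intervalIntegrable _ _)
    ((hP.continuous_swapIntegrand ρ).intervalIntegrable _ _)

/-- Since `swapGain` is monotone in time, its sign at one end of the window decides the sign of the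
integral; the next three lemmas are variants. -/
lemma Standing.swapInt_nonneg (hP : P.Standing) (hρ : 1 ≤ P.pbar * ρ) (hs : 0 ≤ s) (hst : s ≤ t)
    (h : 0 ≤ P.swapGain ρ s) : 0 ≤ P.swapInt ρ s t :=
  intervalIntegral.integral_nonneg hst fun _ hu => mul_nonneg (Real.exp_pos _).le
    (h.trans (hP.monotoneOn_swapGain hρ hs (hs.trans hu.1) hu.1))

lemma Standing.swapInt_pos (hP : P.Standing) (hρ : 1 ≤ P.pbar * ρ) (hs : 0 ≤ s) (hst : s < t)
    (h : 0 ≤ P.swapGain ρ s) (h' : 0 < P.swapGain ρ t) : 0 < P.swapInt ρ s t :=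
  intervalIntegral.integral_pos hst (hP.continuous_swapIntegrand ρ).continuousOn
    (fun _ hu => mul_nonneg (Real.exp_pos _).le
      (h.trans (hP.monotoneOn_swapGain hρ hs (hs.trans hu.1.le) hu.1.le)))
    ⟨t, right_mem_Icc.2 hst.le, mul_pos (Real.exp_pos _) h'⟩

lemma Standing.swapInt_nonpos (hP : P.Standing) (hρ : 1 ≤ P.pbar * ρ) (hs : 0 ≤ s) (hst : s ≤ t)
    (h : P.swapGain ρ t ≤ 0) : P.swapInt ρ s t ≤ 0 := by
  refine neg_nonneg.1 ?_
  rw [swapInt, ← intervalIntegral.integral_neg]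
  exact intervalIntegral.integral_nonneg hst fun u hu => neg_nonneg.2 <|
    mul_nonpos_of_nonneg_of_nonpos (Real.exp_pos _).le
      ((hP.monotoneOn_swapGain hρ (hs.trans hu.1) (hs.trans hst) hu.2).trans h)

lemma Standing.swapInt_neg (hP : P.Standing) (hρ : 1 ≤ P.pbar * ρ) (hs : 0 ≤ s) (hst : s < t)
    (h : P.swapGain ρ t ≤ 0) (h' : P.swapGain ρ s < 0) : P.swapInt ρ s t < 0 := by
  refine neg_pos.1 ?_
  rw [swapInt, ← intervalIntegral.integral_neg]
  exact intervalIntegral.integral_pos hst (hP.continuous_swapIntegrand ρ).neg.continuousOn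
    (fun u hu => neg_nonneg.2 <| mul_nonpos_of_nonneg_of_nonpos (Real.exp_pos _).le
      ((hP.monotoneOn_swapGain hρ (hs.trans hu.1.le) (hs.trans hst.le) hu.2).trans h))
    ⟨s, left_mem_Icc.2 hst.le, neg_pos.2 (mul_neg_of_pos_of_neg (Real.exp_pos _) h')⟩

/-- Less time remaining and a lower belief both reduce the gain from doing earlier. -/
lemma Standing.swapInt_shift_lt (hP : P.Standing) (hρ : 1 ≤ P.pbar * ρ) (hρ' : ρ < ρ')
    (hd : 0 ≤ d) (hds : d ≤ s) (hst : s < t) :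
    Real.exp (P.mu * d) * P.swapInt ρ' (s - d) (t - d) < P.swapInt ρ s t := by
  have h1 : Real.exp (P.mu * d) * P.swapInt ρ' (s - d) (t - d) =
      ∫ r in s..t, Real.exp (P.mu * d) * (Real.exp (P.mu * (r - d)) * P.swapGain ρ' (r - d)) := by
    rw [intervalIntegral.integral_const_mul, swapInt, intervalIntegral.integral_comp_sub_right
      (fun r => Real.exp (P.mu * r) * P.swapGain ρ' r) d]
  -- The factor `exp (mu * d)` equalizes the discount weights of the two windows, so the integrands
  -- compare pointwise.
  have key : ∀ r ∈ Icc s t, Real.exp (P.mu * d) *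
      (Real.exp (P.mu * (r - d)) * P.swapGain ρ' (r - d)) <
      Real.exp (P.mu * r) * P.swapGain ρ r := fun r hr => by
    have he : Real.exp (P.mu * r) = Real.exp (P.mu * d) * Real.exp (P.mu * (r - d)) := by
      rw [← Real.exp_add]; ring_nf
    rw [← mul_assoc, ← he]
    have hrd : 0 ≤ r - d := by linarith [hr.1]
    refine mul_lt_mul_of_pos_left ?_ (Real.exp_pos _)
    exact (hP.swapGain_lt_of_lt hρ' _).trans_le
      (hP.monotoneOn_swapGain hρ hrd (hrd.trans (by linarith)) (by linarith))
  have c1 := hP.continuous_swapIntegrand ρ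
  have c2 := (hP.continuous_swapIntegrand ρ').comp (continuous_sub_right d)
  rw [h1]
  exact intervalIntegral.integral_lt_integral_of_continuousOn_of_le_of_exists_lt hst
    (continuous_const.mul c2).continuousOn c1.continuousOn
    (fun r hr => (key r (Ioc_subset_Icc_self hr)).le)
    ⟨s, left_mem_Icc.2 hst.le, key s (left_mem_Icc.2 hst.le)⟩

end SwapInt

/-! ### Each unit of doing belongs at one end of the thinking. -/

section ShiftGain

variable {T x z τ w : ℝ}

lemma Standing.shiftGain_coeff_pos (hP : P.Standing) (T x : ℝ) :
    0 < P.lam * P.good x * Real.exp (-P.mu * (T - x)) :=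
  mul_pos (mul_pos hP.lam_pos (hP.good_pos x)) (Real.exp_pos _)

/-- If the swap gain at `τ` is nonnegative, so are all those up to `T - x`, and the accumulated gain
is nonnegative. Otherwise those between `z` and `τ` are nonpositive, and postponing to `z` only
lowers the accumulated gain. -/
lemma Standing.min_shiftGain_le (hP : P.Standing) (hx : 0 ≤ x) (hz : 0 ≤ z) (hzτ : z ≤ τ)
    (hτ : τ ≤ T - x) : min 0 (P.shiftGain T x z) ≤ P.shiftGain T x τ := by
  have hC := hP.shiftGain_coeff_pos T x
  have hρ := hP.one_le_odds hx
  rw [hP.shiftGain_eq, hP.shiftGain_eq]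
  rcases le_total 0 (P.swapGain (P.odds x) τ) with h | h
  · exact (min_le_left _ _).trans
      (mul_nonneg hC.le (hP.swapInt_nonneg hρ (hz.trans hzτ) hτ h))
  · refine (min_le_right _ _).trans (mul_le_mul_of_nonneg_left ?_ hC.le)
    have h1 := hP.swapInt_nonpos hρ hz hzτ h
    have h2 := hP.swapInt_add (P.odds x) z τ (T - x)
    linarith

/-- Some earlier doing is required: at the prior itself the curvature bound may hold with equality,
and the swap gain may be constant in time. -/
lemma Standing.min_shiftGain_lt (hP : P.Standing) (hx : 0 < x) (hz : 0 ≤ z) (hzτ : z < τ)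
    (hτ : τ < T - x) : min 0 (P.shiftGain T x z) < P.shiftGain T x τ := by
  have hC := hP.shiftGain_coeff_pos T x
  have hρ := hP.one_le_odds hx.le
  have hmono := hP.strictMonoOn_swapGain (hP.one_lt_odds hx)
  have hτ0 : 0 ≤ τ := hz.trans hzτ.le
  rw [hP.shiftGain_eq, hP.shiftGain_eq]
  rcases le_total 0 (P.swapGain (P.odds x) τ) with h | h
  · exact (min_le_left _ _).trans_lt (mul_pos hC (hP.swapInt_pos hρ hτ0 hτ h
      (h.trans_lt (hmono hτ0 (hτ0.trans hτ.le) hτ))))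
  · refine (min_le_right _ _).trans_lt (mul_lt_mul_of_pos_left ?_ hC)
    have h1 := hP.swapInt_neg hρ hz hzτ h ((hmono hz hτ0 hzτ).trans_le h)
    have h2 := hP.swapInt_add (P.odds x) z τ (T - x)
    linarith

lemma Standing.hasDerivAt_reward_shift (hP : P.Standing) (T w x : ℝ) :
    HasDerivAt (fun x => P.reward T x (w - x)) (P.shiftGain T x (w - x)) x := by
  have h1 := hP.hasDerivAt_doVal x
  have h2 := (((hasDerivAt_id x).const_sub T).const_mul (-P.mu)).exp
  have h3 : HasDerivAt (fun x => P.thinkVal (T - x)) (P.thinkRate (T - x) * -1) x :=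
    (hP.hasDerivAt_thinkVal (T - x)).comp x ((hasDerivAt_id x).const_sub T)
  have h4 : HasDerivAt (fun x => P.thinkVal (w - x)) (P.thinkRate (w - x) * -1) x :=
    (hP.hasDerivAt_thinkVal (w - x)).comp x ((hasDerivAt_id x).const_sub w)
  have h5 := (h1.add (((hasDerivAt_surv (P := P) x).mul h2).mul (h3.sub h4))).add
    ((h1.const_sub (P.doVal w)).const_mul (Real.exp (-P.mu * (T - w))))
  have hfun : (fun x => P.reward T x (w - x)) = fun x => P.doVal x +
      P.surv x * Real.exp (-P.mu * (T - x)) * (P.thinkVal (T - x) - P.thinkVal (w - x)) +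
      Real.exp (-P.mu * (T - w)) * (P.doVal w - P.doVal x) := by
    funext x
    simp only [reward, show T - x - (w - x) = T - w by ring, add_sub_cancel]
  rw [hfun]
  refine h5.congr_deriv ?_
  simp only [shiftGain, id, show T - x - (w - x) = T - w by ring]
  simp only [Pi.mul_apply, Pi.sub_apply]
  ring

lemma Standing.continuous_shiftGain_line (hP : P.Standing) (T w : ℝ) :
    Continuous fun x => P.shiftGain T x (w - x) := by
  have c1 := hP.continuous_thinkVal
  have c2 := hP.continuous_thinkRate
  unfold shiftGain; fun_prop

lemma Standing.integral_shiftGain_line (hP : P.Standing) (T w x : ℝ) :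
    ∫ r in x..w, P.shiftGain T r (w - r) = P.reward T w 0 - P.reward T x (w - x) := by
  rw [intervalIntegral.integral_eq_sub_of_hasDerivAt
    (fun r _ => hP.hasDerivAt_reward_shift T w r)
    ((hP.continuous_shiftGain_line T w).intervalIntegrable _ _), sub_self]

/-- With total doing `w` fixed, raising `x` moves the window from `w - x` to `T - x` closer to the
deadline and lowers the belief. Both reduce the swap gains, so the sign changes at most once. -/
lemma Standing.shiftGain_line_nonpos (hP : P.Standing) (hw : w ≤ T) {x x' : ℝ} (hx : 0 ≤ x)
    (hxx' : x ≤ x') (hx' : x' ≤ w) (h : P.shiftGain T x (w - x) ≤ 0) :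
    P.shiftGain T x' (w - x') ≤ 0 := by
  rcases hxx'.eq_or_lt with rfl | hlt
  · exact h
  rcases hw.eq_or_lt with rfl | hwT
  · simp [hP.shiftGain_eq, swapInt]
  rw [hP.shiftGain_eq] at h ⊢
  have h1 := nonpos_of_mul_nonpos_right h (hP.shiftGain_coeff_pos T x)
  have h2 := hP.swapInt_shift_lt (hP.one_le_odds hx) (hP.strictMono_odds hlt) (d := x' - x)
    (s := w - x) (t := T - x) (by linarith) (by linarith) (by linarith)
  rw [show w - x - (x' - x) = w - x' by ring, show T - x - (x' - x) = T - x' by ring] at h2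
  exact mul_nonpos_of_nonneg_of_nonpos (hP.shiftGain_coeff_pos T x').le
    (nonpos_of_mul_nonpos_right (h2.le.trans h1) (Real.exp_pos _))

/-- Units before the sign switch go first at zero loss and the later ones go last. The pointwise
lower bound on forgone gains is thus attained by a single do-think-do plan. -/
lemma Standing.exists_reward_eq (hP : P.Standing) (hw : w ∈ Icc 0 T) :
    ∃ x ∈ Icc 0 w, P.reward T w 0 - ∫ r in (0 : ℝ)..w, min 0 (P.shiftGain T r (w - r)) =
      P.reward T x (w - x) := by
  have hc := hP.continuous_shiftGain_line T w
  obtain ⟨x, hx, hpos, hneg⟩ := exists_sign_switch hw.1 hc fun u hu v hv huv h =>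
    hP.shiftGain_line_nonpos hw.2 hu.1 huv hv.2 h
  refine ⟨x, hx, ?_⟩
  have hcm : Continuous fun r => min 0 (P.shiftGain T r (w - r)) := continuous_const.min hc
  rw [← intervalIntegral.integral_add_adjacent_intervals (hcm.intervalIntegrable 0 x)
    (hcm.intervalIntegrable x w)]
  have e1 : ∫ r in (0 : ℝ)..x, min 0 (P.shiftGain T r (w - r)) = 0 := by
    suffices h : ∫ r in (0 : ℝ)..x, min 0 (P.shiftGain T r (w - r)) =
        ∫ _ in (0 : ℝ)..x, (0 : ℝ) by rw [h, intervalIntegral.integral_zero]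
    refine intervalIntegral.integral_congr_ae ?_
    filter_upwards [Measure.ae_ne volume x] with r hr hmem
    rw [uIoc_of_le hx.1] at hmem
    exact min_eq_left (hpos r ⟨hmem.1.le, lt_of_le_of_ne hmem.2 hr⟩)
  have e2 : ∫ r in x..w, min 0 (P.shiftGain T r (w - r)) =
      ∫ r in x..w, P.shiftGain T r (w - r) := by
    refine intervalIntegral.integral_congr_ae (.of_forall fun r hmem => ?_)
    rw [uIoc_of_le hx.2] at hmem
    exact min_eq_right (hneg r hmem)
  rw [e1, e2, hP.integral_shiftGain_line]
  ring

end ShiftGain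

/-! ### Domination by do-think-do, and the shape forced by equality. -/

section Optimality

variable {T : ℝ} {a : ℝ → ℝ}

lemma Standing.intervalIntegrable_shiftGain (hP : P.Standing) (hT : 0 ≤ T) (ha : IsPolicy T a) :
    IntervalIntegrable (fun τ => a τ * P.shiftGain T (pastDoing T a τ) τ) volume 0 T := by
  have hL := ha.lipschitzOnWith_pastDoing.continuousOn
  rw [← uIcc_of_le hT] at hL
  exact (ha.intervalIntegrable (left_mem_Icc.2 hT) (right_mem_Icc.2 hT)).mul_continuousOn
    (hP.continuousOn_shiftGain_comp T hL)

/-- Every policy is dominated by one that does, thinks and does, with the same total times. -/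
lemma Standing.payoff_le_reward (hP : P.Standing) (hT : 0 ≤ T) (ha : IsPolicy T a) :
    ∃ x ∈ Icc 0 (pastDoing T a 0), P.payoff T a ≤ P.reward T x (pastDoing T a 0 - x) ∧
      (P.reward T x (pastDoing T a 0 - x) ≤ P.payoff T a → ∀ᵐ τ, τ ∈ Ioc 0 T →
        a τ = 0 ∨ P.shiftGain T (pastDoing T a τ) τ =
          min 0 (P.shiftGain T (pastDoing T a τ) (pastDoing T a 0 - pastDoing T a τ))) := by
  set w := pastDoing T a 0 with hw
  have hwT : w ∈ Icc 0 T := by simpa using ha.pastDoing_mem (left_mem_Icc.2 hT)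
  obtain ⟨x, hx, hxe⟩ := hP.exists_reward_eq hwT
  refine ⟨x, hx, ?_⟩
  set m : ℝ → ℝ := fun r => min 0 (P.shiftGain T r (w - r)) with hm
  have hcm : Continuous m := continuous_const.min (hP.continuous_shiftGain_line T w)
  have hL := ha.lipschitzOnWith_pastDoing.continuousOn
  rw [← uIcc_of_le hT] at hL
  have hi1 := hP.intervalIntegrable_shiftGain hT ha
  have hi2 : IntervalIntegrable (fun τ => a τ * m (pastDoing T a τ)) volume 0 T :=
    (ha.intervalIntegrable (left_mem_Icc.2 hT) (right_mem_Icc.2 hT)).mul_continuousOn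
      (hcm.comp_continuousOn hL)
  have hdiff : P.reward T x (w - x) - P.payoff T a = ∫ τ in (0 : ℝ)..T,
      (a τ * P.shiftGain T (pastDoing T a τ) τ - a τ * m (pastDoing T a τ)) := by
    rw [intervalIntegral.integral_sub hi1 hi2, ha.integral_mul_comp_pastDoing hT hcm,
      hP.payoff_eq hT ha, ← hxe]
    ring
  -- The remaining time is at least the doing still to come, `w - pastDoing T a τ`, and at most `T -
  -- pastDoing T a τ`: exactly the range that `min_shiftGain_le` covers.
  have hnn : ∀ τ ∈ Icc 0 T,
      0 ≤ a τ * P.shiftGain T (pastDoing T a τ) τ - a τ * m (pastDoing T a τ) := fun τ hτ => by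
    rw [← mul_sub]
    have h1 := ha.pastDoing_mem hτ
    have h2 := ha.pastDoing_sub_mem le_rfl hτ.1 hτ.2
    refine mul_nonneg (ha.2 τ hτ).1 (sub_nonneg.2 (hP.min_shiftGain_le h1.1 ?_ ?_ ?_))
    · exact h2.1
    · simpa using h2.2
    · linarith [h1.2]
  refine ⟨sub_nonneg.1 (hdiff ▸ intervalIntegral.integral_nonneg hT hnn), fun hle => ?_⟩
  have hzero : ∫ τ in (0 : ℝ)..T,
      (a τ * P.shiftGain T (pastDoing T a τ) τ - a τ * m (pastDoing T a τ)) = 0 :=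
    le_antisymm (by linarith) (intervalIntegral.integral_nonneg hT hnn)
  rw [intervalIntegral.integral_eq_zero_iff_of_le_of_nonneg_ae hT
    ((ae_restrict_iff' measurableSet_Ioc).2
      (.of_forall fun τ hτ => hnn τ (Ioc_subset_Icc_self hτ))) (hi1.sub hi2)] at hzero
  filter_upwards [(ae_restrict_iff' measurableSet_Ioc).1 hzero] with τ hτ hmem
  have := hτ hmem
  simp only [Pi.zero_apply, ← mul_sub] at this
  rcases mul_eq_zero.1 this with h | h
  · exact .inl h
  · exact .inr (sub_eq_zero.1 h)

lemma IsPolicy.ae_eq_zero (ha : IsPolicy T a) {s t : ℝ} (hs : 0 ≤ s) (hst : s ≤ t) (ht : t ≤ T)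
    (h : pastDoing T a s = pastDoing T a t) : ∀ᵐ τ, τ ∈ Ioo s t → a τ = 0 := by
  have hsm : s ∈ Icc 0 T := ⟨hs, hst.trans ht⟩
  have htm : t ∈ Icc 0 T := ⟨hs.trans hst, ht⟩
  have h1 := ha.pastDoing_sub hsm htm
  rw [h, sub_self, eq_comm, intervalIntegral.integral_eq_zero_iff_of_le_of_nonneg_ae hst
    ((ae_restrict_iff' measurableSet_Ioc).2
      (.of_forall fun τ hτ => (ha.2 τ ⟨hs.trans hτ.1.le, hτ.2.trans ht⟩).1))
    (ha.intervalIntegrable hsm htm)] at h1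
  filter_upwards [(ae_restrict_iff' measurableSet_Ioc).1 h1] with τ hτ hmem
  exact hτ (Ioo_subset_Ioc_self hmem)

lemma IsPolicy.ae_eq_one (ha : IsPolicy T a) {s t : ℝ} (hs : 0 ≤ s) (hst : s ≤ t) (ht : t ≤ T)
    (h : pastDoing T a s - pastDoing T a t = t - s) : ∀ᵐ τ, τ ∈ Ioo s t → a τ = 1 := by
  have hsm : s ∈ Icc 0 T := ⟨hs, hst.trans ht⟩
  have htm : t ∈ Icc 0 T := ⟨hs.trans hst, ht⟩
  have hi := ha.intervalIntegrable hsm htm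
  have h1 : ∫ τ in s..t, (1 - a τ) = 0 := by
    rw [intervalIntegral.integral_sub intervalIntegrable_const hi, ← ha.pastDoing_sub hsm htm, h]
    simp
  rw [intervalIntegral.integral_eq_zero_iff_of_le_of_nonneg_ae hst
    ((ae_restrict_iff' measurableSet_Ioc).2 (.of_forall fun τ hτ =>
      sub_nonneg.2 (ha.2 τ ⟨hs.trans hτ.1.le, hτ.2.trans ht⟩).2))
    (intervalIntegrable_const.sub hi)] at h1
  filter_upwards [(ae_restrict_iff' measurableSet_Ioc).1 h1] with τ hτ hmem
  have := hτ (Ioo_subset_Ioc_self hmem)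
  simp only [Pi.zero_apply] at this
  linarith

lemma IsPolicy.hasPhases_of_pastDoing_eq (ha : IsPolicy T a) (hT : 0 ≤ T)
    (h : pastDoing T a 0 = T) : HasPhases T a 0 0 T where
  nonneg₁ := le_rfl
  nonneg₂ := le_rfl
  nonneg₃ := hT
  total := by simp
  only_doing _ := rfl
  initial := by simp
  thinking := by simp
  final := ha.ae_eq_one le_rfl hT le_rfl (by simp [h, pastDoing_self])

/-- The last three alternatives say that nothing has been done yet, that nothing but doing has
occurred, or that nothing but doing remains. The first allows no doing on a set of positive measure,
and the other two confine it to the two ends. -/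
lemma IsPolicy.exists_hasPhases (ha : IsPolicy T a) (hT : 0 ≤ T) (hlt : pastDoing T a 0 < T)
    (h : ∀ᵐ τ, τ ∈ Ioc 0 T → a τ = 0 ∨ pastDoing T a τ ≤ 0 ∨ T - τ ≤ pastDoing T a τ ∨
      τ ≤ pastDoing T a 0 - pastDoing T a τ) :
    ∃ x y z, 0 < y ∧ HasPhases T a x y z := by
  set X := pastDoing T a with hX
  have hc : ContinuousOn X (Icc 0 T) := ha.lipschitzOnWith_pastDoing.continuousOn
  have hXT : X T = 0 := pastDoing_self
  have h0T : (0 : ℝ) ∈ Icc 0 T := left_mem_Icc.2 hT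
  have hTT : T ∈ Icc 0 T := right_mem_Icc.2 hT
  -- Pure doing lasts until `u` remains and resumes for good when `z` remains; `σ` marks the first
  -- doing, in calendar order.
  obtain ⟨u, ⟨hu, hXu⟩, hul⟩ : ∃ u, IsLeast (Icc 0 T ∩ (fun τ => X τ + τ) ⁻¹' {T}) u :=
    (isCompact_Icc.of_isClosed_subset ((hc.add continuousOn_id).preimage_isClosed_of_isClosed
      isClosed_Icc isClosed_singleton) inter_subset_left).exists_isLeast ⟨T, hTT, by simp [hXT]⟩
  obtain ⟨z, ⟨hz, hXz⟩, hzg⟩ : ∃ z, IsGreatest (Icc 0 T ∩ (fun τ => X τ + τ) ⁻¹' {X 0}) z :=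
    (isCompact_Icc.of_isClosed_subset ((hc.add continuousOn_id).preimage_isClosed_of_isClosed
      isClosed_Icc isClosed_singleton) inter_subset_left).exists_isGreatest ⟨0, h0T, by simp⟩
  obtain ⟨σ, ⟨hσ, hXσ⟩, hσl⟩ : ∃ σ, IsLeast (Icc 0 T ∩ X ⁻¹' {0}) σ :=
    (isCompact_Icc.of_isClosed_subset (hc.preimage_isClosed_of_isClosed
      isClosed_Icc isClosed_singleton) inter_subset_left).exists_isLeast ⟨T, hTT, hXT⟩
  simp only [mem_preimage, mem_singleton_iff] at hXu hXz hXσ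
  have hzu : z < u := by
    by_contra! hle
    have := (ha.pastDoing_sub_mem hu.1 hle hz.2).2
    rw [← hX] at this
    linarith
  have h1 := ha.ae_eq_zero hσ.1 hσ.2 le_rfl (by rw [← hX, hXσ, hXT])
  have hthink : ∀ᵐ τ, τ ∈ Ioo z u → a τ = 0 := by
    filter_upwards [h, h1, Measure.ae_ne volume σ] with τ hτ hτ1 hne hmem
    have hτm : τ ∈ Icc 0 T := ⟨hz.1.trans hmem.1.le, hmem.2.le.trans hu.2⟩
    have hm1 := ha.pastDoing_mem hτm
    have hm2 := ha.pastDoing_sub_mem le_rfl hτm.1 hτm.2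
    rw [← hX] at hm1 hm2
    rcases hτ ⟨hz.1.trans_lt hmem.1, hτm.2⟩ with h' | h' | h' | h'
    · exact h'
    · have : σ ≤ τ := hσl ⟨hτm, le_antisymm h' hm1.1⟩
      exact hτ1 ⟨lt_of_le_of_ne this hne.symm, hmem.2.trans_le hu.2⟩
    · have : u ≤ τ := hul ⟨hτm, by simp only [mem_preimage, mem_singleton_iff]; linarith [hm1.2]⟩
      exact absurd hmem.2 this.not_gt
    · have : τ ≤ z := hzg ⟨hτm, by simp only [mem_preimage, mem_singleton_iff]; linarith [hm2.2]⟩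
      exact absurd hmem.1 this.not_gt
  refine ⟨T - u, u - z, z, sub_pos.2 hzu, ?_⟩
  refine ⟨sub_nonneg.2 hu.2, (sub_pos.2 hzu).le, hz.1, by ring, fun h' => ?_, ?_, ?_, ?_⟩
  · linarith
  · rw [add_sub_cancel]
    exact ha.ae_eq_one hu.1 hu.2 le_rfl (by rw [← hX, hXT]; linarith)
  · rwa [add_sub_cancel]
  · exact ha.ae_eq_one le_rfl hz.1 hz.2 (by rw [← hX]; linarith)

lemma HasPhases.pastDoing_initial {x y z : ℝ} (h : HasPhases T a x y z) {τ : ℝ}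
    (h1 : z + y ≤ τ) (h2 : τ ≤ T) : pastDoing T a τ = T - τ := by
  have : pastDoing T a τ = ∫ _ in τ..T, (1 : ℝ) := by
    refine intervalIntegral.integral_congr_ae ?_
    filter_upwards [h.initial, Measure.ae_ne volume T] with s hs hne hmem
    rw [uIoc_of_le h2] at hmem
    exact hs ⟨h1.trans_lt hmem.1, lt_of_le_of_ne hmem.2 hne⟩
  simpa using this

lemma HasPhases.pastDoing_thinking {x y z : ℝ} (h : HasPhases T a x y z) (ha : IsPolicy T a)
    {τ : ℝ} (h1 : z ≤ τ) (h2 : τ ≤ z + y) : pastDoing T a τ = x := by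
  have hx := h.nonneg₁
  have hz := h.nonneg₃
  have htot := h.total
  have h3 := ha.pastDoing_sub (s := τ) (t := z + y) ⟨hz.trans h1, by linarith⟩
    ⟨by linarith, by linarith⟩
  have h4 : ∫ s in τ..z + y, a s = ∫ _ in τ..z + y, (0 : ℝ) := by
    refine intervalIntegral.integral_congr_ae ?_
    filter_upwards [h.thinking, Measure.ae_ne volume (z + y)] with s hs hne hmem
    rw [uIoc_of_le h2] at hmem
    exact hs ⟨h1.trans_lt hmem.1, lt_of_le_of_ne hmem.2 hne⟩
  rw [h4, h.pastDoing_initial le_rfl (by linarith), intervalIntegral.integral_zero] at h3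
  linarith

lemma HasPhases.pastDoing_final {x y z : ℝ} (h : HasPhases T a x y z) (ha : IsPolicy T a)
    {τ : ℝ} (h1 : 0 ≤ τ) (h2 : τ ≤ z) : pastDoing T a τ = x + z - τ := by
  have hx := h.nonneg₁
  have hy := h.nonneg₂
  have htot := h.total
  have h3 := ha.pastDoing_sub (s := τ) (t := z) ⟨h1, by linarith⟩ ⟨by linarith, by linarith⟩
  have h4 : ∫ s in τ..z, a s = ∫ _ in τ..z, (1 : ℝ) := by
    refine intervalIntegral.integral_congr_ae ?_
    filter_upwards [h.final, Measure.ae_ne volume z] with s hs hne hmem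
    rw [uIoc_of_le h2] at hmem
    exact hs ⟨h1.trans_lt hmem.1, lt_of_le_of_ne hmem.2 hne⟩
  rw [h4, h.pastDoing_thinking ha le_rfl (by linarith)] at h3
  simp only [intervalIntegral.integral_const, smul_eq_mul, mul_one] at h3
  linarith

/-- Initial doing forgoes nothing, as no thinking precedes it. Final doing runs along the line of
constant total doing, where `shiftGain` is the derivative of `reward`. -/
lemma HasPhases.payoff_eq {x y z : ℝ} (h : HasPhases T a x y z) (hP : P.Standing)
    (ha : IsPolicy T a) : P.payoff T a = P.reward T x z := by
  have hx := h.nonneg₁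
  have hy := h.nonneg₂
  have hz := h.nonneg₃
  have htot := h.total
  have hT : 0 ≤ T := by linarith
  have hi := hP.intervalIntegrable_shiftGain hT ha
  have hsub : ∀ s ∈ Icc 0 T, ∀ t ∈ Icc 0 T, uIcc s t ⊆ uIcc 0 T := fun s hs t ht => by
    rw [uIcc_of_le hT]; exact uIcc_subset_Icc hs ht
  have m0 : (0 : ℝ) ∈ Icc 0 T := ⟨le_rfl, hT⟩
  have m1 : z ∈ Icc 0 T := ⟨hz, by linarith⟩
  have m2 : z + y ∈ Icc 0 T := ⟨by linarith, by linarith⟩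
  have m3 : T ∈ Icc 0 T := ⟨hT, le_rfl⟩
  have i1 := hi.mono_set (hsub _ m0 _ m1)
  have i2 := hi.mono_set (hsub _ m1 _ m2)
  have i3 := hi.mono_set (hsub _ m2 _ m3)
  have e1 : ∫ τ in (0 : ℝ)..z, a τ * P.shiftGain T (pastDoing T a τ) τ =
      P.reward T (x + z) 0 - P.reward T x z := by
    have : ∫ τ in (0 : ℝ)..z, a τ * P.shiftGain T (pastDoing T a τ) τ =
        ∫ τ in (0 : ℝ)..z, (fun r => P.shiftGain T r (x + z - r)) (x + z - τ) := by
      refine intervalIntegral.integral_congr_ae ?_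
      filter_upwards [h.final, Measure.ae_ne volume z] with s hs hne hmem
      rw [uIoc_of_le hz] at hmem
      rw [hs ⟨hmem.1, lt_of_le_of_ne hmem.2 hne⟩, h.pastDoing_final ha hmem.1.le hmem.2, one_mul,
        sub_sub_cancel]
    rw [this, intervalIntegral.integral_comp_sub_left (fun r => P.shiftGain T r (x + z - r)),
      add_sub_cancel_right, sub_zero, hP.integral_shiftGain_line, add_sub_cancel_left]
  have e2 : ∫ τ in z..z + y, a τ * P.shiftGain T (pastDoing T a τ) τ = 0 := by
    rw [← intervalIntegral.integral_zero (a := z) (b := z + y) (μ := volume) (E := ℝ)]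
    refine intervalIntegral.integral_congr_ae ?_
    filter_upwards [h.thinking, Measure.ae_ne volume (z + y)] with s hs hne hmem
    rw [uIoc_of_le (by linarith)] at hmem
    rw [hs ⟨hmem.1, lt_of_le_of_ne hmem.2 hne⟩, zero_mul]
  have e3 : ∫ τ in z + y..T, a τ * P.shiftGain T (pastDoing T a τ) τ = 0 := by
    rw [← intervalIntegral.integral_zero (a := z + y) (b := T) (μ := volume) (E := ℝ)]
    refine intervalIntegral.integral_congr_ae (.of_forall fun s hmem => ?_)
    rw [uIoc_of_le m2.2] at hmem
    rw [h.pastDoing_initial hmem.1.le hmem.2, hP.shiftGain_eq, sub_sub_cancel]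
    simp [swapInt]
  rw [hP.payoff_eq hT ha, h.pastDoing_final ha le_rfl hz, sub_zero,
    ← intervalIntegral.integral_add_adjacent_intervals (i1.trans i2) i3,
    ← intervalIntegral.integral_add_adjacent_intervals i1 i2, e1, e2, e3]
  ring

/-- Doing until time `z + y` remains, thinking until time `z` remains, then doing. -/
def phasePolicy (z y : ℝ) : ℝ → ℝ := (Ioo z (z + y))ᶜ.indicator 1

lemma isPolicy_phasePolicy (T z y : ℝ) : IsPolicy T (phasePolicy z y) := by
  refine ⟨measurable_one.indicator measurableSet_Ioo.compl, fun τ _ => ?_⟩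
  unfold phasePolicy
  by_cases h : τ ∈ (Ioo z (z + y))ᶜ
  · simp [indicator_of_mem h]
  · simp [indicator_of_notMem h]

lemma hasPhases_phasePolicy {x y z : ℝ} (hx : 0 ≤ x) (hy : 0 < y) (hz : 0 ≤ z)
    (h : x + y + z = T) : HasPhases T (phasePolicy z y) x y z where
  nonneg₁ := hx
  nonneg₂ := hy.le
  nonneg₃ := hz
  total := h
  only_doing h0 := absurd h0 hy.ne'
  initial := .of_forall fun τ hτ => by
    have : τ ∈ (Ioo z (z + y))ᶜ := fun hm => hτ.1.not_gt hm.2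
    rw [phasePolicy, indicator_of_mem this]; rfl
  thinking := .of_forall fun τ hτ => by
    have : τ ∉ (Ioo z (z + y))ᶜ := fun hm => hm hτ
    rw [phasePolicy, indicator_of_notMem this]
  final := .of_forall fun τ hτ => by
    have : τ ∈ (Ioo z (z + y))ᶜ := fun hm => hτ.2.not_gt hm.1
    rw [phasePolicy, indicator_of_mem this]; rfl

lemma hasPhases_one (hT : 0 ≤ T) : HasPhases T (fun _ => 1) 0 0 T where
  nonneg₁ := le_rfl
  nonneg₂ := le_rfl
  nonneg₃ := hT
  total := by simp
  only_doing _ := rfl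
  initial := .of_forall fun _ _ => rfl
  thinking := by simp
  final := .of_forall fun _ _ => rfl

lemma isPolicy_one (T : ℝ) : IsPolicy T fun _ => 1 :=
  ⟨measurable_const, fun _ _ => by simp⟩

lemma reward_of_add_eq {x z : ℝ} (h : x + z = T) : P.reward T x z = P.doVal T := by
  subst h
  simp [reward]

/-- On the edge `x + z = T` nothing is thought and the split is immaterial; the convention
`only_doing` then requires the phases `0, 0, T`. -/
lemma Standing.exists_payoff_eq_reward (hP : P.Standing) {x z : ℝ} (hx : 0 ≤ x) (hz : 0 ≤ z)
    (h : x + z ≤ T) : ∃ a, IsPolicy T a ∧ P.payoff T a = P.reward T x z := by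
  rcases h.eq_or_lt with h | h
  · have hT : 0 ≤ T := by linarith
    refine ⟨_, isPolicy_one T, ?_⟩
    rw [(hasPhases_one hT).payoff_eq hP (isPolicy_one T), reward_of_add_eq h,
      reward_of_add_eq (zero_add T)]
  · have hy : 0 < T - x - z := by linarith
    exact ⟨_, isPolicy_phasePolicy T z _, (hasPhases_phasePolicy hx hy hz
      (by ring)).payoff_eq hP (isPolicy_phasePolicy T z _)⟩

end Optimality

end ThinkDo

/-! ### First-order conditions for the two switching times. -/

lemma HasDerivAt.nonpos_of_forall_right_le {f : ℝ → ℝ} {f' c d : ℝ} (h : HasDerivAt f f' c)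
    (hd : c < d) (hle : ∀ t ∈ Ioo c d, f t ≤ f c) : f' ≤ 0 := by
  have h1 := (hasDerivWithinAt_iff_tendsto_slope' (s := Ioi c) (by simp)).1 h.hasDerivWithinAt
  refine le_of_tendsto h1 ?_
  filter_upwards [Ioo_mem_nhdsGT hd] with t ht
  rw [slope_def_field]
  exact div_nonpos_of_nonpos_of_nonneg (sub_nonpos.2 (hle t ht)) (sub_nonneg.2 ht.1.le)

lemma HasDerivAt.nonneg_of_forall_left_le {f : ℝ → ℝ} {f' c d : ℝ} (h : HasDerivAt f f' c)
    (hd : d < c) (hle : ∀ t ∈ Ioo d c, f t ≤ f c) : 0 ≤ f' := by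
  have h1 := (hasDerivWithinAt_iff_tendsto_slope' (s := Iio c) (by simp)).1 h.hasDerivWithinAt
  refine ge_of_tendsto h1 ?_
  filter_upwards [Ioo_mem_nhdsLT hd] with t ht
  rw [slope_def_field]
  exact div_nonneg_of_nonpos (sub_nonpos.2 (hle t ht)) (sub_nonpos.2 ht.2.le)

namespace ThinkDo

variable {P : ThinkDo}

/-- Annuity value, on a good arm, of doing rather than thinking for the remaining time `z`. -/
def doStake (P : ThinkDo) (z : ℝ) : ℝ :=
  P.mu * ((1 - Real.exp (-P.lam * z)) * (P.B - P.c / P.lam) + P.c * z) +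
    Real.exp (-P.lam * z) * (P.lam * P.B - P.c) + P.c

/-- Marginal gain, relative to the good state, from prolonging thinking when time `z` remains. -/
def thinkGain (P : ThinkDo) (ρ z : ℝ) : ℝ := ρ * P.mu * (P.val z + P.c * z) - P.doStake z

lemma Standing.doStake_pos (hP : P.Standing) {z : ℝ} (hz : 0 ≤ z) : 0 < P.doStake z := by
  have hl := hP.lam_pos
  have hc := hP.c_pos
  have hB := hP.B_pos
  have h0 := Real.exp_pos (-P.lam * z)
  have h1 : Real.exp (-P.lam * z) ≤ 1 := Real.exp_le_one_iff.2 (by nlinarith)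
  have h2 := Real.add_one_le_exp (-P.lam * z)
  -- Regrouping turns the cost terms into a multiple of `exp (-lam * z) - 1 + lam * z`, which is
  -- nonnegative by convexity.
  have h3 : (1 - Real.exp (-P.lam * z)) * (P.B - P.c / P.lam) + P.c * z =
      (1 - Real.exp (-P.lam * z)) * P.B +
        P.c / P.lam * (Real.exp (-P.lam * z) - (-P.lam * z + 1)) := by
    field_simp; ring
  have h4 : 0 ≤ (1 - Real.exp (-P.lam * z)) * (P.B - P.c / P.lam) + P.c * z := by
    rw [h3]
    exact add_nonneg (mul_nonneg (by linarith) hB.le)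
      (mul_nonneg (div_pos hc hl).le (by linarith))
  have h5 : 0 < Real.exp (-P.lam * z) * (P.lam * P.B) := by positivity
  have h6 : 0 ≤ (1 - Real.exp (-P.lam * z)) * P.c := mul_nonneg (by linarith) hc.le
  unfold doStake
  nlinarith [mul_nonneg hP.mu_pos.le h4]

lemma Standing.hasDerivAt_doStake (hP : P.Standing) (z : ℝ) : HasDerivAt P.doStake
    (P.lam * (P.mu * P.B + P.c + P.mu * P.c * z) - P.lam * P.doStake z) z := by
  have h1 := ((hasDerivAt_id z).const_mul (-P.lam)).exp
  have h2 := ((h1.const_sub 1).mul_const (P.B - P.c / P.lam)).add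
    ((hasDerivAt_id z).const_mul P.c)
  have h3 := ((h2.const_mul P.mu).add (h1.mul_const (P.lam * P.B - P.c))).add_const P.c
  refine h3.congr_deriv ?_
  have := hP.lam_pos.ne'
  simp only [doStake, id]
  field_simp
  ring

lemma Standing.hasDerivAt_thinkGain (hP : P.Standing) (ρ z : ℝ) : HasDerivAt (P.thinkGain ρ)
    (ρ * P.mu * (P.val' z + P.c) -
      (P.lam * (P.mu * P.B + P.c + P.mu * P.c * z) - P.lam * P.doStake z)) z := by
  have h1 := (((hP.hasDerivAt_val z).add ((hasDerivAt_id z).const_mul P.c)).const_mul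
    (ρ * P.mu)).sub (hP.hasDerivAt_doStake z)
  exact h1.congr_deriv (by ring)

lemma Standing.one_lt_of_one_le_mul (hP : P.Standing) {ρ : ℝ} (hρ : 1 ≤ P.pbar * ρ) : 1 < ρ := by
  have h0 := hP.pbar_pos
  have h1 := hP.pbar_lt_one
  by_contra! h
  nlinarith

/-- Where earlier doing is not profitable, the gain from thinking crosses zero only upwards. -/
lemma Standing.thinkGain_pos_of_lt (hP : P.Standing) {ρ z w : ℝ} (hρ : 1 ≤ P.pbar * ρ)
    (hz : 0 ≤ z) (hzw : z < w) (h : 0 ≤ P.thinkGain ρ z) (hw : P.swapGain ρ w ≤ 0) :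
    0 < P.thinkGain ρ w := by
  have hρ1 := hP.one_lt_of_one_le_mul hρ
  have hρ0 : 0 < ρ := by linarith
  have hl := hP.lam_pos
  have hm := hP.mu_pos
  -- Integrating factor: `thinkGain' + (lam / ρ) thinkGain = lam (1 - 1 / ρ) doStake - lam
  -- swapGain`, which is positive where `swapGain ≤ 0`, because `ρ > 1`.
  set f : ℝ → ℝ := fun r => Real.exp (P.lam / ρ * r) * P.thinkGain ρ r with hf
  have hd : ∀ r, HasDerivAt f (Real.exp (P.lam / ρ * r) *
      (P.lam * (1 - ρ⁻¹) * P.doStake r - P.lam * P.swapGain ρ r)) r := fun r => by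
    refine ((((hasDerivAt_id r).const_mul (P.lam / ρ)).exp).mul
      (hP.hasDerivAt_thinkGain ρ r)).congr_deriv ?_
    simp only [id, thinkGain, swapGain]
    field_simp
    ring
  have hmono : StrictMonoOn f (Icc z w) := by
    refine strictMonoOn_of_hasDerivWithinAt_pos (convex_Icc z w)
      (fun r _ => (hd r).continuousAt.continuousWithinAt)
      (fun r _ => (hd r).hasDerivWithinAt) fun r hr => ?_
    rw [interior_Icc] at hr
    have hr0 : 0 ≤ r := hz.trans hr.1.le
    have h1 : P.swapGain ρ r ≤ 0 :=
      (hP.monotoneOn_swapGain hρ hr0 (hr0.trans hr.2.le) hr.2.le).trans hw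
    have h2 : 0 < 1 - ρ⁻¹ := sub_pos.2 (inv_lt_one_of_one_lt₀ hρ1)
    have h3 : 0 < P.lam * (1 - ρ⁻¹) * P.doStake r :=
      mul_pos (mul_pos hl h2) (hP.doStake_pos hr0)
    have h4 := mul_nonpos_of_nonneg_of_nonpos hl.le h1
    exact mul_pos (Real.exp_pos _) (by linarith)
  have h1 := hmono (left_mem_Icc.2 hzw.le) (right_mem_Icc.2 hzw.le) hzw
  have h2 : 0 ≤ f z := mul_nonneg (Real.exp_pos _).le h
  exact pos_of_mul_pos_right (h2.trans_lt h1) (Real.exp_pos _).le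

lemma Standing.thinkGain_lt_of_lt (hP : P.Standing) {ρ ρ' z : ℝ} (h : ρ < ρ') (hz : 0 < z) :
    P.thinkGain ρ z < P.thinkGain ρ' z := by
  have h1 : 0 < P.mu * (P.val z + P.c * z) :=
    mul_pos hP.mu_pos (add_pos_of_nonneg_of_pos (hP.val_nonneg hz.le) (mul_pos hP.c_pos hz))
  have := mul_lt_mul_of_pos_right h h1
  unfold thinkGain
  linarith

lemma Standing.thinkGain_zero_neg (hP : P.Standing) (ρ : ℝ) : P.thinkGain ρ 0 < 0 := by
  have := hP.doStake_pos le_rfl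
  simp only [thinkGain, hP.val_zero]
  linarith

/-- Raising `z` at fixed `x` trades the last bit of thinking for doing, so the first-order condition
for when to stop thinking is a zero of `thinkGain`. -/
lemma Standing.hasDerivAt_reward (hP : P.Standing) (T x z : ℝ) :
    HasDerivAt (fun z => P.reward T x z)
      (-(Real.exp (-P.mu * (T - x - z)) * P.good x * P.thinkGain (P.odds x) z)) z := by
  have h1 := ((hP.hasDerivAt_thinkVal z).const_sub (P.thinkVal (T - x))).const_mul
    (P.surv x * Real.exp (-P.mu * (T - x)))
  have h2 : HasDerivAt (fun z => P.doVal (x + z)) (P.doRate (x + z) * 1) z :=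
    (hP.hasDerivAt_doVal (x + z)).comp z ((hasDerivAt_id z).const_add x)
  have h3 := (((hasDerivAt_id z).const_sub (T - x)).const_mul (-P.mu)).exp
  refine ((h1.const_add (P.doVal x)).add (h3.mul (h2.sub_const (P.doVal x)))).congr_deriv ?_
  have he : Real.exp (-P.mu * (T - x - z)) = Real.exp (-P.mu * (T - x)) * Real.exp (P.mu * z) := by
    rw [← Real.exp_add]; ring_nf
  have hg : P.good (x + z) = P.good x * Real.exp (-P.lam * z) := by
    simp only [good, mul_assoc, ← Real.exp_add]; ring_nf
  have hs : P.good x * P.odds x = P.surv x := (hP.surv_eq x).symm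
  have hs' : P.surv x = 1 - P.pbar + P.good x := rfl
  have hl := hP.lam_pos.ne'
  have key : P.good x * P.thinkGain (P.odds x) z = P.surv x * (P.mu * P.val z - P.c) -
      P.mu * (P.doVal (x + z) - P.doVal x) - P.doRate (x + z) := by
    have : P.good x * P.thinkGain (P.odds x) z =
        P.surv x * P.mu * (P.val z + P.c * z) - P.good x * P.doStake z := by
      rw [← hs, thinkGain]; ring
    rw [this, hs']
    simp only [doStake, doVal, doRate, surv, hg]
    field_simp
    ring
  rw [mul_assoc _ (P.good x), key]
  simp only [id, he, thinkRate]
  ring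

/-- The necessary conditions for doing for a time `x`, then thinking for a positive time `y`, then
doing for a time `z`. -/
structure IsCandidate (P : ThinkDo) (T x y z : ℝ) : Prop where
  nonneg_x : 0 ≤ x
  pos_y : 0 < y
  pos_z : 0 < z
  total : x + y + z = T
  thinkGain_eq : P.thinkGain (P.odds x) z = 0
  swapGain_nonpos : P.swapGain (P.odds x) z ≤ 0
  swapInt_nonpos : P.swapInt (P.odds x) z (z + y) ≤ 0
  swapInt_eq : 0 < x → P.swapInt (P.odds x) z (z + y) = 0

lemma Standing.isCandidate_of_forall_le (hP : P.Standing) {T x y z : ℝ} (hx : 0 ≤ x) (hy : 0 < y)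
    (hz : 0 ≤ z) (htot : x + y + z = T)
    (hmax : ∀ x' z', 0 ≤ x' → 0 ≤ z' → x' + z' ≤ T → P.reward T x' z' ≤ P.reward T x z) :
    P.IsCandidate T x y z := by
  have hcoef : 0 < Real.exp (-P.mu * (T - x - z)) * P.good x :=
    mul_pos (Real.exp_pos _) (hP.good_pos x)
  have hd := hP.hasDerivAt_reward T x z
  have h1 : 0 ≤ P.thinkGain (P.odds x) z := by
    have := hd.nonpos_of_forall_right_le (d := z + y) (by linarith)
      fun t ht => hmax x t hx (hz.trans ht.1.le) (by linarith [ht.2])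
    exact nonneg_of_mul_nonneg_right (by linarith) hcoef
  -- Progress at the deadline is worth nothing, so thinking never lasts until the deadline.
  have hz0 : 0 < z := by
    refine hz.lt_of_ne' fun h => ?_
    rw [h] at h1
    exact (hP.thinkGain_zero_neg _).not_ge h1
  have h2 : P.thinkGain (P.odds x) z ≤ 0 := by
    have := hd.nonneg_of_forall_left_le hz0
      fun t ht => hmax x t hx ht.1.le (by linarith [ht.2])
    exact nonpos_of_mul_nonpos_right (by linarith) hcoef
  -- The other direction of variation moves doing across the thinking phase, keeping `x + z` fixed.
  have hd' := hP.hasDerivAt_reward_shift T (x + z) x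
  rw [add_sub_cancel_left, hP.shiftGain_eq, show T - x = z + y by linarith] at hd'
  have hC : 0 < P.lam * P.good x * Real.exp (-P.mu * (z + y)) :=
    mul_pos (mul_pos hP.lam_pos (hP.good_pos x)) (Real.exp_pos _)
  have hρ := hP.one_le_odds hx
  have h3 : P.swapInt (P.odds x) z (z + y) ≤ 0 := by
    have := hd'.nonpos_of_forall_right_le (d := x + z) (by linarith) fun t ht => by
      rw [add_sub_cancel_left]
      exact hmax t (x + z - t) (hx.trans ht.1.le) (by linarith [ht.2]) (by linarith)
    exact nonpos_of_mul_nonpos_right this hC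
  refine ⟨hx, hy, hz0, htot, le_antisymm h2 h1, ?_, h3, fun hx0 => le_antisymm h3 ?_⟩
  · by_contra! hpos
    refine h3.not_gt (hP.swapInt_pos hρ hz (by linarith) hpos.le (hpos.trans_le ?_))
    exact hP.monotoneOn_swapGain hρ hz (mem_Ici.2 (by linarith)) (by linarith)
  · have := hd'.nonneg_of_forall_left_le hx0 fun t ht => by
      rw [add_sub_cancel_left]
      exact hmax t (x + z - t) ht.1.le (by linarith [ht.2]) (by linarith)
    exact nonneg_of_mul_nonneg_right this hC

/-! ### Comparative statics of candidates. -/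

section Comparison

variable {T T' x x' y y' z z' : ℝ}

/-- A lower belief raises the gain from thinking, so at `z` it is nonnegative for `x'`. Were `z'`
larger, single crossing would make it positive at `z'`, where it vanishes. -/
lemma IsCandidate.z_le_of_le (hP : P.Standing) (h : P.IsCandidate T x y z)
    (h' : P.IsCandidate T' x' y' z') (hx : x ≤ x') : z' ≤ z := by
  by_contra! hlt
  have h1 : 0 ≤ P.thinkGain (P.odds x') z := by
    rcases hx.eq_or_lt with rfl | hx
    · exact h.thinkGain_eq.ge
    · exact h.thinkGain_eq.ge.trans
        (hP.thinkGain_lt_of_lt (hP.strictMono_odds hx) h.pos_z).le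
  exact (hP.thinkGain_pos_of_lt (hP.one_le_odds h'.nonneg_x) h.pos_z.le hlt h1
    h'.swapGain_nonpos).ne' h'.thinkGain_eq

/-- Align the thinking windows at their lower ends: length `y` at `z'` accumulates a negative swap
gain. As swap gains increase with time remaining, the window must be longer than `y` for the total
to reach zero. -/
lemma IsCandidate.y_lt_of_lt (hP : P.Standing) (h : P.IsCandidate T x y z)
    (h' : P.IsCandidate T' x' y' z') (hx : x < x') : y < y' := by
  have hz := h.z_le_of_le hP h' hx.le
  have hρ' := hP.one_le_odds h'.nonneg_x
  have hy := h.pos_y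
  have hz' := h'.pos_z
  have hy' := h'.pos_y
  have h1 := hP.swapInt_shift_lt (hP.one_le_odds h.nonneg_x) (hP.strictMono_odds hx)
    (d := z - z') (s := z) (t := z + y) (by linarith) (by linarith) (by linarith)
  rw [sub_sub_cancel, show z + y - (z - z') = z' + y by ring] at h1
  have h2 : P.swapInt (P.odds x') z' (z' + y) < 0 :=
    neg_of_mul_neg_right (h1.trans_le h.swapInt_nonpos) (Real.exp_pos _).le
  by_contra! hle
  have h3 := h'.swapInt_eq (h.nonneg_x.trans_lt hx)
  have h4 := hP.swapInt_add (P.odds x') z' (z' + y') (z' + y)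
  have h5 : 0 ≤ P.swapGain (P.odds x') (z' + y') := by
    by_contra! hneg
    refine (hP.swapInt_neg hρ' hz'.le (by linarith) hneg.le (lt_of_le_of_lt ?_ hneg)).ne h3
    exact hP.monotoneOn_swapGain hρ' hz'.le (mem_Ici.2 (by linarith)) (by linarith)
  have h6 := hP.swapInt_nonneg hρ' (s := z' + y') (t := z' + y) (by linarith) (by linarith) h5
  linarith

/-- Align the windows at their upper ends instead. If `T' ≤ T`, the top part of length `y` of the
second window has negative total; by monotonicity the part below it is nonpositive, so the whole
cannot vanish. -/
lemma IsCandidate.lt_of_lt (hP : P.Standing) (h : P.IsCandidate T x y z)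
    (h' : P.IsCandidate T' x' y' z') (hx : x < x') : T < T' := by
  by_contra! hT
  have hyy := h.y_lt_of_lt hP h' hx
  have hρ' := hP.one_le_odds h'.nonneg_x
  have hz' := h'.pos_z
  have ht := h.total
  have ht' := h'.total
  have hy := h.pos_y
  have h1 := hP.swapInt_shift_lt (hP.one_le_odds h.nonneg_x) (hP.strictMono_odds hx)
    (d := z + y - (z' + y')) (s := z) (t := z + y) (by linarith) (by linarith) (by linarith)
  rw [sub_sub_cancel, show z - (z + y - (z' + y')) = z' + y' - y by ring] at h1
  have h2 : P.swapInt (P.odds x') (z' + y' - y) (z' + y') < 0 :=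
    neg_of_mul_neg_right (h1.trans_le h.swapInt_nonpos) (Real.exp_pos _).le
  have h3 := h'.swapInt_eq (h.nonneg_x.trans_lt hx)
  have h4 := hP.swapInt_add (P.odds x') z' (z' + y' - y) (z' + y')
  have h5 : P.swapGain (P.odds x') (z' + y' - y) ≤ 0 := by
    by_contra! hpos
    exact h2.not_ge (hP.swapInt_nonneg hρ' (by linarith) (by linarith) hpos.le)
  have h6 := hP.swapInt_nonpos hρ' hz'.le (t := z' + y' - y) (by linarith) h5
  linarith

lemma IsCandidate.mono (hP : P.Standing) (h : P.IsCandidate T x y z)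
    (h' : P.IsCandidate T' x' y' z') (hT : T ≤ T') : x ≤ x' ∧ y ≤ y' := by
  rcases lt_trichotomy x x' with hx | rfl | hx
  · exact ⟨hx.le, (h.y_lt_of_lt hP h' hx).le⟩
  · refine ⟨le_rfl, ?_⟩
    have hz : z = z' := le_antisymm (h'.z_le_of_le hP h le_rfl) (h.z_le_of_le hP h' le_rfl)
    have := h.total
    have := h'.total
    linarith
  · exact absurd (h'.lt_of_lt hP h hx) hT.not_gt

/-- A brief spell of thinking inserted when `w` remains improves on uninterrupted doing to first
order. -/
lemma Standing.exists_lt_reward (hP : P.Standing) {w : ℝ} (hx : 0 ≤ x) (hw : 0 < w)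
    (hT : x + w = T) (h : 0 < P.thinkGain (P.odds x) w) :
    ∃ x z, 0 ≤ x ∧ 0 ≤ z ∧ x + z ≤ T ∧ P.doVal T < P.reward T x z := by
  by_contra! hcon
  have hd := (hP.hasDerivAt_reward T x w).nonneg_of_forall_left_le hw fun t ht => by
    rw [reward_of_add_eq hT]
    exact hcon x t hx ht.1.le (by linarith [ht.2])
  have := mul_pos (mul_pos (Real.exp_pos (-P.mu * (T - x - w))) (hP.good_pos x)) h
  linarith

/-- If some thinking is worthwhile for a deadline, it is so for every later deadline. -/
lemma IsCandidate.exists_lt_reward (hP : P.Standing) (h : P.IsCandidate T x y z) (hT : T ≤ T') :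
    ∃ x z, 0 ≤ x ∧ 0 ≤ z ∧ x + z ≤ T' ∧ P.doVal T' < P.reward T' x z := by
  have hx := h.nonneg_x
  have hy := h.pos_y
  have hz := h.pos_z
  have htot := h.total
  -- Seek a point on the all-doing path with `thinkGain > 0`. If the swap gain is nonpositive at
  -- `x`, single crossing from `z` up to `T' - x` suffices; otherwise move along the path to a zero
  -- of the swap gain and argue there.
  rcases le_or_gt (P.swapGain (P.odds x) (T' - x)) 0 with hs | hs
  · exact hP.exists_lt_reward hx (w := T' - x) (by linarith) (by ring)
      (hP.thinkGain_pos_of_lt (hP.one_le_odds hx) hz.le (by linarith) h.thinkGain_eq.ge hs)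
  · have hcont : ContinuousOn (fun r => P.swapGain (P.odds r) (T' - r)) (Icc x (T' - z)) := by
      have c1 := hP.continuous_val
      have c2 := hP.continuous_val'
      unfold swapGain
      fun_prop
    have hend : P.swapGain (P.odds (T' - z)) (T' - (T' - z)) ≤ 0 := by
      rw [sub_sub_cancel]
      exact (hP.swapGain_lt_of_lt (hP.strictMono_odds (by linarith)) z).le.trans h.swapGain_nonpos
    obtain ⟨r, hr, hr0⟩ := intermediate_value_Icc' (by linarith) hcont ⟨hend, hs.le⟩
    simp only at hr0
    have hxr : x < r := hr.1.lt_of_ne fun he => by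
      rw [← he] at hr0
      linarith
    have h1 : 0 < P.thinkGain (P.odds r) z :=
      h.thinkGain_eq.ge.trans_lt (hP.thinkGain_lt_of_lt (hP.strictMono_odds hxr) hz)
    have hr1 : 0 ≤ r := hx.trans hr.1
    have hzr : z ≤ T' - r := by linarith [hr.2]
    refine hP.exists_lt_reward hr1 (w := T' - r) (by linarith) (by ring) ?_
    rcases hzr.eq_or_lt with he | hlt
    · rwa [← he]
    · exact hP.thinkGain_pos_of_lt (hP.one_le_odds hr1) hz.le hlt h1.le hr0.le

lemma Standing.exists_thinkGain_lower (hP : P.Standing) : ∃ δ C : ℝ, 0 < δ ∧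
    ∀ x z, 0 ≤ x → 0 ≤ z → δ * z - C ≤ P.thinkGain (P.odds x) z := by
  have hm := hP.mu_pos
  have hc := hP.c_pos
  have ho := hP.one_lt_of_one_le_mul (hP.one_le_odds le_rfl)
  -- The slope is the difference of the linear cost terms of thinking and doing, at the prior odds;
  -- the constant bounds the remaining terms of `doStake`.
  refine ⟨P.mu * P.c * (P.odds 0 - 1), P.mu * |P.B - P.c / P.lam| + |P.lam * P.B - P.c| + P.c,
    mul_pos (mul_pos hm hc) (by linarith), fun x z hx hz => ?_⟩
  have h0 := Real.exp_pos (-P.lam * z)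
  have h1 : Real.exp (-P.lam * z) ≤ 1 := Real.exp_le_one_iff.2 (by nlinarith [hP.lam_pos])
  have h2 : (1 - Real.exp (-P.lam * z)) * (P.B - P.c / P.lam) ≤ |P.B - P.c / P.lam| :=
    (mul_le_mul_of_nonneg_left (le_abs_self _) (by linarith)).trans
      (mul_le_of_le_one_left (abs_nonneg _) (by linarith))
  have h3 : Real.exp (-P.lam * z) * (P.lam * P.B - P.c) ≤ |P.lam * P.B - P.c| :=
    (mul_le_mul_of_nonneg_left (le_abs_self _) h0.le).trans
      (mul_le_of_le_one_left (abs_nonneg _) h1)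
  have h4 : P.odds 0 ≤ P.odds x := hP.strictMono_odds.monotone hx
  have h5 : P.odds 0 * P.mu * (P.c * z) ≤ P.odds x * P.mu * (P.val z + P.c * z) := by
    have := hP.val_nonneg hz
    have := mul_nonneg hc.le hz
    gcongr
    · exact mul_nonneg (by linarith) hm.le
    · linarith
  have h6 := mul_le_mul_of_nonneg_left h2 hm.le
  unfold thinkGain doStake
  linarith

/-- If `x > 0`, the swap gains over the thinking phase cancel, so the one at its start is
nonnegative. This bounds `odds x`, which grows at least linearly in `x`. -/
lemma Standing.exists_candidate_x_le (hP : P.Standing) :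
    ∃ M : ℝ, ∀ T x y z, P.IsCandidate T x y z → x ≤ M := by
  have hm := hP.mu_pos
  have hl := hP.lam_pos
  have hc := hP.c_pos
  have hB := hP.B_pos
  have hk : 0 < (1 - P.pbar) / P.pbar := div_pos (sub_pos.2 hP.pbar_lt_one) hP.pbar_pos
  refine ⟨(P.mu * P.B + P.c) / ((1 - P.pbar) / P.pbar * P.mu * P.c), fun T x y z h => ?_⟩
  rw [le_div_iff₀ (by positivity)]
  rcases h.nonneg_x.eq_or_lt with rfl | hx
  · rw [zero_mul]; positivity
  have hz := h.pos_z
  have hy := h.pos_y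
  have hρ := hP.one_le_odds hx.le
  have h1 : 0 ≤ P.swapGain (P.odds x) (z + y) := by
    by_contra! hneg
    refine (hP.swapInt_neg hρ hz.le (by linarith) hneg.le (lt_of_le_of_lt ?_ hneg)).ne
      (h.swapInt_eq hx)
    exact hP.monotoneOn_swapGain hρ hz.le (mem_Ici.2 (by linarith)) (by linarith)
  have h2 := hP.val_nonneg (τ := z + y) (by linarith)
  have h3 := hP.val'_pos (z + y)
  have h4 : (1 - P.pbar) / P.pbar * (P.lam * x) ≤ P.odds x := by
    have := mul_le_mul_of_nonneg_left (Real.add_one_le_exp (P.lam * x)) hk.le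
    unfold odds
    linarith
  have h5 : P.mu / P.lam * ((1 - P.pbar) / P.pbar * (P.lam * x)) * P.c ≤
      P.mu / P.lam * P.odds x * (P.val' (z + y) + P.c) := by
    have : 0 ≤ P.odds x := le_trans (by positivity) h4
    gcongr
    linarith
  have h6 : P.mu / P.lam * ((1 - P.pbar) / P.pbar * (P.lam * x)) * P.c =
      x * ((1 - P.pbar) / P.pbar * P.mu * P.c) := by
    field_simp
  have h7 := mul_nonneg hm.le h2
  unfold swapGain at h1
  linarith

end Comparison

/-! ### Existence, shape and uniqueness of the optimum. -/

section Solution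

variable {T : ℝ} {a : ℝ → ℝ}

lemma Standing.exists_isOptimal (hP : P.Standing) (hT : 0 ≤ T) : ∃ a, P.IsOptimal T a := by
  have hcomp : IsCompact (Icc (0 : ℝ) T ×ˢ Icc (0 : ℝ) T ∩ {q | q.1 + q.2 ≤ T}) :=
    (isCompact_Icc.prod isCompact_Icc).inter_right
      (isClosed_le (by fun_prop) continuous_const)
  obtain ⟨q, hq, hmax⟩ := hcomp.exists_isMaxOn ⟨(0, 0), by simp [hT]⟩
    (hP.continuous_reward T).continuousOn
  obtain ⟨a, ha, hpay⟩ := hP.exists_payoff_eq_reward hq.1.1.1 hq.1.2.1 hq.2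
  refine ⟨a, ha, fun b hb => ?_⟩
  obtain ⟨x, hx, hle, -⟩ := hP.payoff_le_reward hT hb
  have hw : pastDoing T b 0 ≤ T := by simpa using (hb.pastDoing_mem (left_mem_Icc.2 hT)).2
  rw [hpay]
  refine hle.trans (hmax (a := (x, pastDoing T b 0 - x)) ⟨⟨⟨hx.1, hx.2.trans hw⟩, ?_, ?_⟩, ?_⟩)
  · exact sub_nonneg.2 hx.2
  · simp only; linarith [hx.1]
  · simpa using hw

lemma IsOptimal.reward_le (ha : P.IsOptimal T a) (hP : P.Standing) {x z : ℝ} (hx : 0 ≤ x)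
    (hz : 0 ≤ z) (h : x + z ≤ T) : P.reward T x z ≤ P.payoff T a := by
  obtain ⟨b, hb, hpay⟩ := hP.exists_payoff_eq_reward hx hz h
  rw [← hpay]
  exact ha.2 b hb

lemma IsOptimal.hasPhases (ha : P.IsOptimal T a) (hP : P.Standing) (hT : 0 ≤ T) :
    (HasPhases T a 0 0 T ∧
      ∀ x z, 0 ≤ x → 0 ≤ z → x + z ≤ T → P.reward T x z ≤ P.doVal T) ∨
    ∃ x y z, HasPhases T a x y z ∧ P.IsCandidate T x y z := by
  have hw : pastDoing T a 0 ≤ T := by simpa using (ha.1.pastDoing_mem (left_mem_Icc.2 hT)).2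
  rcases hw.eq_or_lt with h | h
  · have hph := ha.1.hasPhases_of_pastDoing_eq hT h
    refine .inl ⟨hph, fun x z hx hz hxz => ?_⟩
    rw [← reward_of_add_eq (P := P) (zero_add T), ← hph.payoff_eq hP ha.1]
    exact ha.reward_le hP hx hz hxz
  · obtain ⟨x₀, hx₀, -, heq⟩ := hP.payoff_le_reward hT ha.1
    have hae := heq (ha.reward_le hP hx₀.1 (sub_nonneg.2 hx₀.2) (by linarith))
    obtain ⟨x, y, z, hy, hph⟩ := ha.1.exists_hasPhases hT h (by
      filter_upwards [hae] with τ hτ hmem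
      have hm := ha.1.pastDoing_sub_mem le_rfl hmem.1.le hmem.2
      rcases hτ hmem with h0 | h0
      · exact .inl h0
      · by_contra! hcon
        -- Doing strictly inside the feasible range, after some earlier doing, loses strictly,
        -- against the equality that optimality forces.
        exact (hP.min_shiftGain_lt hcon.2.1 (z := pastDoing T a 0 - pastDoing T a τ) hm.1
          hcon.2.2.2 (by linarith [hcon.2.2.1])).ne' h0)
    refine .inr ⟨x, y, z, hph, hP.isCandidate_of_forall_le hph.nonneg₁ hy hph.nonneg₃ hph.total
      fun x' z' hx' hz' h' => ?_⟩
    rw [← hph.payoff_eq hP ha.1]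
    exact ha.reward_le hP hx' hz' h'

/-- A candidate shows that some thinking beats none, so all optima are of the same kind. Two
candidates for one deadline coincide by comparing them in both directions. -/
lemma Standing.exists_phases (hP : P.Standing) (hT : 0 ≤ T) :
    ∃ x y z, (∀ a, P.IsOptimal T a → HasPhases T a x y z) ∧
      (P.IsCandidate T x y z ∨ (x = 0 ∧ y = 0 ∧
        ∀ x' z', 0 ≤ x' → 0 ≤ z' → x' + z' ≤ T → P.reward T x' z' ≤ P.doVal T)) := by
  obtain ⟨a₀, ha₀⟩ := hP.exists_isOptimal hT
  have excl : ∀ x y z, P.IsCandidate T x y z →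
      ¬∀ x' z', 0 ≤ x' → 0 ≤ z' → x' + z' ≤ T → P.reward T x' z' ≤ P.doVal T :=
    fun x y z h hall => by
      obtain ⟨x', z', h1, h2, h3, h4⟩ := h.exists_lt_reward hP le_rfl
      exact (hall x' z' h1 h2 h3).not_gt h4
  rcases ha₀.hasPhases hP hT with ⟨-, hall⟩ | ⟨x, y, z, -, hc⟩
  · refine ⟨0, 0, T, fun a ha => ?_, .inr ⟨rfl, rfl, hall⟩⟩
    rcases ha.hasPhases hP hT with ⟨h, -⟩ | ⟨x, y, z, -, hc⟩
    · exact h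
    · exact absurd hall (excl x y z hc)
  · refine ⟨x, y, z, fun a ha => ?_, .inl hc⟩
    rcases ha.hasPhases hP hT with ⟨-, hall⟩ | ⟨x', y', z', h, hc'⟩
    · exact absurd hall (excl x y z hc)
    · have h1 := hc.mono hP hc' le_rfl
      have h2 := hc'.mono hP hc le_rfl
      obtain rfl : x = x' := le_antisymm h1.1 h2.1
      obtain rfl : y = y' := le_antisymm h1.2 h2.2
      obtain rfl : z = z' := by linarith [hc.total, hc'.total]
      exact h

end Solution

end ThinkDo

end

/-! ### Assembly: monotone phases and unbounded thinking. -/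

theorem proposition6 (P : ThinkDo) (hP : P.Standing) :
    ∃ τ₁ τ₂ τ₃ : ℝ → ℝ,
      (∀ T, 0 < T →
        (∃ a, P.IsOptimal T a) ∧
        ∀ a, P.IsOptimal T a → ThinkDo.HasPhases T a (τ₁ T) (τ₂ T) (τ₃ T)) ∧
      MonotoneOn τ₁ (Ioi 0) ∧
      MonotoneOn τ₂ (Ioi 0) ∧
      Tendsto τ₂ atTop atTop := by
  have hex : ∀ T : ℝ, ∃ x y z, 0 < T →
      (∀ a, P.IsOptimal T a → ThinkDo.HasPhases T a x y z) ∧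
      (P.IsCandidate T x y z ∨ (x = 0 ∧ y = 0 ∧
        ∀ x' z', 0 ≤ x' → 0 ≤ z' → x' + z' ≤ T → P.reward T x' z' ≤ P.doVal T)) := fun T => by
    by_cases hT : 0 < T
    · obtain ⟨x, y, z, h⟩ := hP.exists_phases hT.le
      exact ⟨x, y, z, fun _ => h⟩
    · exact ⟨0, 0, 0, fun h => absurd h hT⟩
  choose τ₁ τ₂ τ₃ hτ using hex
  have hmono : ∀ T ∈ Ioi (0 : ℝ), ∀ T' ∈ Ioi (0 : ℝ), T ≤ T' →
      τ₁ T ≤ τ₁ T' ∧ τ₂ T ≤ τ₂ T' := fun T hT T' hT' hle => by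
    rcases (hτ T hT).2 with hc | ⟨h1, h2, -⟩ <;> rcases (hτ T' hT').2 with hc' | ⟨h1', h2', hall⟩
    · exact hc.mono hP hc' hle
    · obtain ⟨x, z, hx, hz, hxz, hlt⟩ := hc.exists_lt_reward hP hle
      exact absurd (hall x z hx hz hxz) hlt.not_ge
    · rw [h1, h2]
      exact ⟨hc'.nonneg_x, hc'.pos_y.le⟩
    · rw [h1, h2, h1', h2']
      exact ⟨le_rfl, le_rfl⟩
  refine ⟨τ₁, τ₂, τ₃, fun T hT => ⟨hP.exists_isOptimal hT.le, (hτ T hT).1⟩,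
    fun T hT T' hT' h => (hmono T hT T' hT' h).1,
    fun T hT T' hT' h => (hmono T hT T' hT' h).2, ?_⟩
  obtain ⟨δ, C, hδ, hlow⟩ := hP.exists_thinkGain_lower
  obtain ⟨M, hM⟩ := hP.exists_candidate_x_le
  -- With `x ≤ M`, and `z ≤ C / δ` from `thinkGain = 0`, thinking takes at least the rest of the
  -- time.
  refine tendsto_atTop_mono' atTop (f₁ := fun T => T + -(M + C / δ)) ?_
    (tendsto_atTop_add_const_right _ _ tendsto_id)
  filter_upwards [eventually_gt_atTop 0, eventually_gt_atTop (C / δ)] with T hT hTC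
  rcases (hτ T hT).2 with hc | ⟨-, -, hall⟩
  · have h1 := hM _ _ _ _ hc
    have h2 := hlow (τ₁ T) (τ₃ T) hc.nonneg_x hc.pos_z.le
    rw [hc.thinkGain_eq] at h2
    have h3 : τ₃ T ≤ C / δ := by
      rw [le_div_iff₀ hδ]; linarith
    linarith [hc.total]
  -- Never thinking is ruled out for `T > C / δ`: thinking briefly at the very start already pays.
  · have h1 := hlow 0 T le_rfl hT.le
    have h2 : 0 < δ * T - C := by
      rw [div_lt_iff₀ hδ] at hTC; linarith
    obtain ⟨x, z, hx, hz, hxz, hlt⟩ := hP.exists_lt_reward le_rfl hT (zero_add T)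
      (h2.trans_le h1)
    exact absurd (hall x z hx hz hxz) hlt.not_ge
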